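/- Let $K$ be an arbitrary field and let $f\in K[X,Y]$ be an irreducible polynomial of total degree $d$. Let $\mathcal F: f(X,Y)=0$ be the corresponding plane curve, $F(X,Y,Z)=Z^{d}f(X/Z,Y/Z)$ the homogeneous equation of its projective closure, and $K(\mathcal F)$ its function field, i.e. the field of fractions of $K[X,Y]/(f)$. Let $x,y\in K(\mathcal F)$ be such that $K(\mathcal F)=K(x,y)$ and $f(x,y)=0$. A place $P$ of $K(\mathcal F)$ is a discrete valuation ring of $K(\mathcal F)$ containing $K$; $v_P$ is its normalized valuation, and $\deg P$ is the degree over $K$ of its residue field. For $z\in K(\mathcal F)$, a pole of $z$ is a place $P$ with $v_P(z)<0$, and $\operatorname{div}(z)_\infty=\sum_{v_P(z)<0}(-v_P(z))\,P$ is the pole divisor of $z$ (equal to $0$ if $z$ has no poles, e.g. if $z$ is constant). The multiplicity of a point on $\mathcal F$ is the least degree of a term of the equation of $\mathcal F$ in an affine chart centred at that point (it is $0$ if the point does not lie on $\mathcal F$). Then for all integers $l,m\ge 0$ the following assertions are equivalent: (a) The functions $x$ and $y$ have no common poles, $\deg(\operatorname{div}(x)_\infty)=l$ and $\deg(\operatorname{div}(y)_\infty)=m$.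 (b) $d=m+l$ and, after multiplying $f$ by a suitable nonzero constant of $K$, $f(X,Y)=X^mY^l+g(X,Y)$, where $g\in K[X,Y]$ has total degree $<m+l$, degree $\le m$ in $X$ and degree $\le l$ in $Y$. (c) The points $O_1=(1:0:0)$ and $O_2=(0:1:0)$ have respective multiplicities $l$ and $m$ on $\mathcal F$, and $m+l=d$. -/

import Mathlib

namespace PlaneCurve

open MvPolynomial LinearAlgebra.Projectivization

/-! ### Plane curves, their homogenizations and multiplicities of points -/

section Plane

variable {K : Type*} [Field K]

/-- The coordinate ring `K[X, Y] / (f)` of the affine curve `f(X, Y) = 0`. The variables `X` and `Y`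
are `X 0` and `X 1`. -/
abbrev CoordinateRing (f : MvPolynomial (Fin 2) K) : Type _ :=
  MvPolynomial (Fin 2) K ⧸ Ideal.span {f}

/-- The homogenization `F(X, Y, Z) = Z ^ d * f(X / Z, Y / Z)` of `f(X, Y)`, with `d` the total degree
of `f`: each term `a X ^ i Y ^ j` becomes `a X ^ i Y ^ j Z ^ (d - i - j)`. -/
noncomputable def homogenization (f : MvPolynomial (Fin 2) K) : MvPolynomial (Fin 3) K :=
  ∑ s ∈ f.support, C (f.coeff s) * (X 0 ^ s 0 * X 1 ^ s 1 * X 2 ^ (f.totalDegree - s 0 - s 1))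

/-- The index of the first nonzero entry of a nonzero vector of homogeneous coordinates. -/
noncomputable def chartIndex (v : Fin 3 → K) : Fin 3 :=
  open Classical in if v 0 ≠ 0 then 0 else if v 1 ≠ 0 then 1 else 2

/-- The equation of the curve `F = 0` in the affine chart in which the coordinate number `i` is `1`,
translated so that the point with homogeneous coordinates `v` becomes the origin. -/
noncomputable def localEquation (F : MvPolynomial (Fin 3) K) (v : Fin 3 → K) (i : Fin 3) :
    MvPolynomial (Fin 2) K :=
  aeval (i.insertNth (α := fun _ => MvPolynomial (Fin 2) K) 1
    (fun j : Fin 2 => X j + C (v (i.succAbove j) / v i))) F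

theorem chartIndex_smul (v : Fin 3 → K) {t : K} (ht : t ≠ 0) :
    chartIndex (t • v) = chartIndex v := by
  by_cases h0 : v 0 = 0 <;> by_cases h1 : v 1 = 0 <;> simp [chartIndex, ht, h0, h1]

theorem localEquation_smul (F : MvPolynomial (Fin 3) K) (v : Fin 3 → K) (i : Fin 3) {t : K}
    (ht : t ≠ 0) : localEquation F (t • v) i = localEquation F v i := by
  simp [localEquation, mul_div_mul_left _ _ ht]

/-- The multiplicity of the point `P` of the projective plane on the curve `F = 0`, for a form `F`:
the least degree of a term of the local equation of the curve at `P`. It is `0` if and only if `P`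
does not lie on the curve. -/
noncomputable def multiplicity (F : MvPolynomial (Fin 3) K) (P : ℙ K (Fin 3 → K)) : ℕ∞ :=
  Projectivization.lift
    (fun v : { v : Fin 3 → K // v ≠ 0 } =>
      (localEquation F v.1 (chartIndex v.1) : MvPowerSeries (Fin 2) K).order)
    (by
      rintro ⟨a, ha⟩ ⟨b, hb⟩ t (rfl : a = t • b)
      have ht : t ≠ 0 := by
        rintro rfl
        exact ha (zero_smul K b)
      simp only [chartIndex_smul b ht, localEquation_smul F b _ ht])
    P

variable (K) in
/-- The point `(1 : 0 : 0)`. -/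
noncomputable def O₁ : ℙ K (Fin 3 → K) :=
  Projectivization.mk K ![1, 0, 0] (fun h => one_ne_zero (congrFun h 0))

variable (K) in
/-- The point `(0 : 1 : 0)`. -/
noncomputable def O₂ : ℙ K (Fin 3 → K) :=
  Projectivization.mk K ![0, 1, 0] (fun h => one_ne_zero (congrFun h 1))

end Plane

/-! ### Places of a function field and pole divisors -/

section Places

variable (K L : Type*) [Field K] [Field L] [Algebra K L]

/-- A place of `L` over `K`: a discrete valuation ring of `L` that contains `K`. When `L` is the
function field of a curve over `K`, these are the (closed) points of its nonsingular model. -/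
structure Place where
  /-- The valuation ring. -/
  ring : ValuationSubring L
  isDVR : IsDiscreteValuationRing ring
  algebraMap_mem : ∀ a : K, algebraMap K L a ∈ ring

namespace Place

variable {K L}

instance (P : Place K L) : IsDiscreteValuationRing P.ring := P.isDVR

instance (P : Place K L) : Algebra K P.ring :=
  ((algebraMap K L).codRestrict P.ring P.algebraMap_mem).toAlgebra

/-- The normalized discrete valuation of a place, written multiplicatively: it is `exp (- v_P(x))`
at `x ≠ 0`. -/
noncomputable def valuation (P : Place K L) : Valuation L (WithZero (Multiplicative ℤ)) :=
  (IsDiscreteValuationRing.maximalIdeal P.ring).valuation L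

/-- `P` is a pole of `x`: `v_P(x) < 0`. -/
def IsPole (P : Place K L) (x : L) : Prop := 1 < P.valuation x

/-- The order of the pole of `x` at `P`, that is `max (- v_P(x)) 0`; it is `0` at `x = 0`. -/
noncomputable def poleOrder (P : Place K L) (x : L) : ℕ := (WithZero.log (P.valuation x)).toNat

/-- The degree of a place: the degree over `K` of its residue field. -/
noncomputable def degree (P : Place K L) : ℕ :=
  Module.finrank K (IsLocalRing.ResidueField P.ring)

end Place

variable {K L}

/-- The degree `∑ n_P deg P` of an effective divisor `∑ n_P P`. -/
noncomputable def divisorDegree (D : Place K L →₀ ℕ) : ℕ := D.sum fun P n => n * P.degree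

/-- `D` is the pole divisor of `x`: the coefficient of each place is the pole order of `x` there. -/
def IsPoleDivisor (D : Place K L →₀ ℕ) (x : L) : Prop := ∀ P, D P = P.poleOrder x

end Places

end PlaneCurve

/-! All three assertions say the same thing about three numbers: `deg_X f = m`, `deg_Y f = l` and `d
= m + l`. The equality `d = deg_X f + deg_Y f` means that `f` contains the corner term, the monomial
whose exponents are the two partial degrees. For (b) this is a reading of the terms of `f`
(`exists_eq_X_pow_mul_X_pow_add_iff`). For (c), dehomogenizing at `O₁` and `O₂` shows that the
multiplicities are `d - deg_X f` and `d - deg_Y f` (`multiplicity_O₁`, `multiplicity_O₂`).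

For (a), the pole divisor of a transcendental `x` has degree `[L : K(x)]`
(`exists_isPoleDivisor_of_transcendental`), and `[L : K(y)] = deg_X f`, symmetrically for `x`. The
inequality `≤` for the pole divisor comes from weak approximation, and `≥` from comparing dimensions
of spaces of functions with bounded poles.

Common poles are detected by the corner term. If it occurs in `f`, it strictly dominates every other
term at a common pole, contradicting `f(x, y) = 0`. If there is no common pole, then `1/x` and `1/y`
generate the unit ideal of `K[1/x, 1/y]`. This yields a polynomial with constant term `1` vanishing
at `(1/x, 1/y)`; its reciprocal polynomial vanishes at `(x, y)`, so it is a multiple of `f`, and it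
has a corner term, a property inherited by factors. -/

namespace PlaneCurve

open IntermediateField

/-! ### Linear independence over `K(t)` tested modulo `t`. -/

section Quotient

variable {K L : Type*} [Field K] [Field L] [Algebra K L]

/-- If the polynomials `p i` in `t` satisfy a linear relation with coefficients `b i` in a
`t`-stable subspace `M`, and the `b i` are independent over `K` modulo `tM`, then the `p i` are
zero. -/
theorem eq_zero_of_sum_aeval_mul_eq_zero {t : L} (ht : t ≠ 0) {M : Submodule K L}
    (hM : ∀ z ∈ M, t * z ∈ M) {ι : Type*} [Fintype ι] {b : ι → L} (hb : ∀ i, b i ∈ M)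
    (hind : ∀ c : ι → K, (∃ z ∈ M, ∑ i, c i • b i = t * z) → ∀ i, c i = 0)
    (n : ℕ) (p : ι → Polynomial K) (hn : ∀ i, (p i).natDegree < n)
    (hp : ∑ i, Polynomial.aeval t (p i) * b i = 0) : ∀ i, p i = 0 := by
  have hpow : ∀ q : Polynomial K, ∀ z ∈ M, Polynomial.aeval t q * z ∈ M := by
    intro q z hz
    induction q using Polynomial.induction_on' with
    | add q r hq hr => rw [map_add, add_mul]; exact M.add_mem hq hr
    | monomial k a =>
      rw [Polynomial.aeval_monomial, mul_assoc, ← Algebra.smul_def]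
      refine M.smul_mem _ ?_
      induction k with
      | zero => simpa using hz
      | succ k ih => rw [pow_succ', mul_assoc]; exact hM _ ih
  induction n generalizing p with
  | zero => exact fun i => absurd (hn i) (Nat.not_lt_zero _)
  | succ n ih =>
    have hdec : ∀ i, Polynomial.aeval t (p i) =
        t * Polynomial.aeval t (p i).divX + algebraMap K L ((p i).coeff 0) := by
      intro i
      conv_lhs => rw [← Polynomial.X_mul_divX_add (p i)]
      rw [map_add, map_mul, Polynomial.aeval_X, Polynomial.aeval_C]
    -- Modulo `tM` only the constant coefficients survive, so `hind` kills them and the relation can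
    -- be divided by `t`.
    have hsum : ∑ i, (p i).coeff 0 • b i =
        t * -∑ i, Polynomial.aeval t (p i).divX * b i := by
      rw [← sub_eq_zero, ← hp, mul_neg, sub_neg_eq_add, Finset.mul_sum, ← Finset.sum_add_distrib]
      refine Finset.sum_congr rfl fun i _ => ?_
      rw [hdec i, Algebra.smul_def]
      ring
    have h0 := hind _ ⟨_, M.neg_mem (M.sum_mem fun i _ => hpow _ _ (hb i)), hsum⟩
    have hp' : ∑ i, Polynomial.aeval t (p i).divX * b i = 0 := by
      have : t * -∑ i, Polynomial.aeval t (p i).divX * b i = 0 := by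
        rw [← hsum]; exact Finset.sum_eq_zero fun i _ => by rw [h0 i, zero_smul]
      simpa [ht] using this
    have hp0 : ∀ i, p i = Polynomial.X * (p i).divX := by
      intro i
      conv_lhs => rw [← Polynomial.X_mul_divX_add (p i), h0 i]
      simp
    -- For `n = 0` the `p i` are constants and `divX` cannot have degree `< 0`; the vanishing of the
    -- constant coefficients already suffices.
    by_cases hn0 : n = 0
    · subst hn0
      intro i
      rw [Polynomial.eq_C_of_natDegree_eq_zero (Nat.lt_one_iff.1 (hn i)), h0 i, map_zero]
    · have := ih (fun i => (p i).divX) (fun i => by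
        rw [Polynomial.natDegree_divX_eq_natDegree_tsub_one]
        have := hn i
        omega) hp'
      intro i
      rw [hp0 i, this i, mul_zero]

/-- `K(t)` is the fraction field of `K[t]`, so it is enough to treat relations with coefficients
polynomial in `t`. -/
theorem linearIndependent_adjoin_of_forall_mod {t : L} (ht : t ≠ 0) {M : Submodule K L}
    (hM : ∀ z ∈ M, t * z ∈ M) {ι : Type*} [Finite ι] {b : ι → L} (hb : ∀ i, b i ∈ M)
    (hind : ∀ [Fintype ι], ∀ c : ι → K, (∃ z ∈ M, ∑ i, c i • b i = t * z) → ∀ i, c i = 0) :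
    LinearIndependent K⟮t⟯ b := by
  have := Fintype.ofFinite ι
  open algebraAdjoinAdjoin in
  rw [← LinearIndependent.iff_fractionRing (Algebra.adjoin K {t}) K⟮t⟯]
  rw [Fintype.linearIndependent_iff]
  intro g hg
  have hex : ∀ i, ∃ p : Polynomial K, Polynomial.aeval t p = (g i : L) := fun i =>
    (Algebra.adjoin_singleton_eq_range_aeval K t).le (g i).2
  choose p hp using hex
  have := eq_zero_of_sum_aeval_mul_eq_zero ht hM hb hind
    (Finset.univ.sup (fun i => (p i).natDegree) + 1) p
    (fun i => Nat.lt_succ_of_le (Finset.le_sup (f := fun i => (p i).natDegree)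
      (Finset.mem_univ i)))
    (by simp only [hp]; exact hg)
  intro i
  apply Subtype.ext
  rw [← hp i, this i, map_zero]
  rfl

/-- Lifts to `M` of a `K`-independent family of `N` are independent modulo `tM`, hence over `K(t)`.
This is the source of every upper bound by `[L : K(t)]`. -/
theorem finite_and_finrank_le_of_ker_le {t : L} (ht : t ≠ 0) [FiniteDimensional K⟮t⟯ L]
    {M : Submodule K L} (hM : ∀ z ∈ M, t * z ∈ M) {N : Type*} [AddCommGroup N] [Module K N]
    (φ : M →ₗ[K] N) (hφ : Function.Surjective φ)
    (hker : ∀ z w : M, (z : L) = t * w → φ z = 0) :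
    Module.Finite K N ∧ Module.finrank K N ≤ Module.finrank K⟮t⟯ L := by
  have hrank : Module.rank K N ≤ (Module.finrank K⟮t⟯ L : ℕ) := by
    refine rank_le fun s hs => ?_
    choose b hb using fun n : s => hφ n
    have hli : LinearIndependent K⟮t⟯ (fun i => (b i : L)) := by
      refine linearIndependent_adjoin_of_forall_mod ht hM (fun i => (b i).2) ?_
      rintro _ c ⟨z, hz, hzc⟩
      have h0 := hker (∑ i, c i • b i) ⟨z, hz⟩ (by simpa using hzc)
      rw [map_sum] at h0
      simp only [map_smul, hb] at h0
      exact Fintype.linearIndependent_iff.1 hs c h0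
    simpa using hli.fintype_card_le_finrank
  have hfin : Module.Finite K N :=
    Module.rank_lt_aleph0_iff.1 (hrank.trans_lt (Cardinal.natCast_lt_aleph0))
  refine ⟨hfin, ?_⟩
  rw [← Module.finrank_eq_rank] at hrank
  exact_mod_cast hrank

end Quotient

end PlaneCurve

namespace PlaneCurve

open IntermediateField

/-! ### Valuation rings of `L` over `K` and existence of places. -/

section ValuationRings

variable {K L : Type*} [Field K] [Field L] [Algebra K L]

theorem inv_mem_of_isAlgebraic {V : ValuationSubring L} (hV : ∀ a : K, algebraMap K L a ∈ V)
    {z : L} (hz : IsAlgebraic K z) : z⁻¹ ∈ V := by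
  have hint : IsIntegral K z⁻¹ := hz.inv.isIntegral
  let : Algebra K V := ((algebraMap K L).codRestrict V hV).toAlgebra
  have : IsScalarTower K V L := .of_algebraMap_eq fun _ => rfl
  obtain ⟨w, hw⟩ := IsIntegrallyClosed.isIntegral_iff.1 (hint.tower_top (A := V))
  rw [← hw]
  exact w.2

theorem mem_of_isAlgebraic {V : ValuationSubring L} (hV : ∀ a : K, algebraMap K L a ∈ V)
    {z : L} (hz : IsAlgebraic K z) : z ∈ V := by
  simpa using inv_mem_of_isAlgebraic hV hz.inv

theorem transcendental_of_mem_nonunits {V : ValuationSubring L}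
    (hV : ∀ a : K, algebraMap K L a ∈ V) {z : L} (hz : z ∈ V.nonunits) (hz0 : z ≠ 0) :
    Transcendental K z := fun h =>
  (V.mem_nonunits_iff_or.1 hz).elim hz0 fun h' => h' (inv_mem_of_isAlgebraic hV h)

/-- The quotient of a valuation ring `V ⊇ K` of `L` by a principal ideal `(t)` has dimension at most
`[L : K(t)]`. -/
theorem finite_quotient_span {V : ValuationSubring L} [Algebra K V] [IsScalarTower K V L]
    {t : V} (ht : t ≠ 0) [FiniteDimensional K⟮(t : L)⟯ L] :
    Module.Finite K (V ⧸ Ideal.span {t}) := by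
  have ht' : (t : L) ≠ 0 := by simpa using ht
  let M : Submodule K L := LinearMap.range (IsScalarTower.toAlgHom K V L).toLinearMap
  have hmem : ∀ z : M, (z : L) ∈ V := by rintro ⟨_, w, rfl⟩; exact w.2
  let φ : M →ₗ[K] (V ⧸ Ideal.span {t}) :=
    { toFun := fun z => Ideal.Quotient.mk _ ⟨z, hmem z⟩
      map_add' := fun z w => rfl
      map_smul' := fun c z => by
        rw [RingHom.id_apply, Algebra.smul_def, IsScalarTower.algebraMap_apply K V,
          Ideal.Quotient.algebraMap_eq, ← map_mul]
        congr 1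
        apply Subtype.ext
        rw [Submodule.coe_smul, Algebra.smul_def, IsScalarTower.algebraMap_apply K V L]
        rfl }
  refine (finite_and_finrank_le_of_ker_le ht' (M := M) ?_ φ ?_ ?_).1
  · rintro _ ⟨w, rfl⟩
    exact ⟨t * w, map_mul (algebraMap V L) t w⟩
  · intro q
    obtain ⟨w, rfl⟩ := Ideal.Quotient.mk_surjective q
    exact ⟨⟨w, w, rfl⟩, rfl⟩
  · intro z w hzw
    refine Ideal.Quotient.eq_zero_iff_mem.2 (Ideal.mem_span_singleton.2 ⟨⟨w, hmem w⟩, ?_⟩)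
    exact Subtype.ext hzw

/-- A nonzero nonunit `a` is transcendental, so `V / (a)` is finite-dimensional over `K`, hence
Noetherian; an ideal containing `a` is then finitely generated. A Noetherian valuation ring is
principal, and `V ≠ ⊤` keeps it from being a field. -/
theorem isDiscreteValuationRing_of_finiteDimensional
    (hfin : ∀ z : L, Transcendental K z → FiniteDimensional K⟮z⟯ L)
    {V : ValuationSubring L} (hV : ∀ a : K, algebraMap K L a ∈ V) (hne : V ≠ ⊤) :
    IsDiscreteValuationRing V := by
  let : Algebra K V := ((algebraMap K L).codRestrict V hV).toAlgebra
  have : IsScalarTower K V L := .of_algebraMap_eq fun _ => rfl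
  have hnoeth : IsNoetherianRing V := by
    refine ⟨fun I => ?_⟩
    by_cases hI : I = ⊥
    · rw [hI]; exact Submodule.fg_bot
    obtain ⟨a, haI, ha0⟩ := Submodule.exists_mem_ne_zero_of_ne_bot hI
    by_cases hu : IsUnit a
    · rw [Ideal.eq_top_of_isUnit_mem _ haI hu]; exact ⟨{1}, by simp⟩
    have ht : Transcendental K (a : L) := transcendental_of_mem_nonunits hV
      (V.coe_mem_nonunits_iff.2 hu) (by simpa using ha0)
    have := hfin _ ht
    have := finite_quotient_span (K := K) ha0
    have : IsNoetherianRing (V ⧸ Ideal.span {a}) := isNoetherian_of_tower K inferInstance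
    refine Ideal.fg_of_fg_map_of_fg_inf_ker_of_surjective (f := Ideal.Quotient.mk (Ideal.span {a}))
      (IsNoetherian.noetherian _) ?_ Ideal.Quotient.mk_surjective
    rw [Ideal.mk_ker, inf_eq_right.2 ((Ideal.span_singleton_le_iff_mem I).2 haI)]
    exact ⟨{a}, by simp⟩
  have hpir : IsPrincipalIdealRing V := inferInstance
  refine { not_a_field' := fun h => hne ?_ }
  refine top_le_iff.1 fun z _ => ?_
  by_contra hz
  have hz' : z⁻¹ ∈ V.nonunits := V.inv_mem_nonunits_iff.2 (Or.inr hz)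
  have hz0 : z⁻¹ = 0 := by
    have := V.coe_mem_nonunits_iff.1 (show ((⟨z⁻¹, V.nonunits_le hz'⟩ : V) : L) ∈ _ from hz')
    rw [h] at this
    exact congrArg Subtype.val ((Submodule.mem_bot _).1 this)
  rw [inv_eq_zero] at hz0
  exact hz (hz0 ▸ V.zero_mem)

namespace Place

instance (P : Place K L) : IsScalarTower K P.ring L := .of_algebraMap_eq fun _ => rfl

theorem valuation_le_one_iff (P : Place K L) {z : L} : P.valuation z ≤ 1 ↔ z ∈ P.ring := by
  constructor
  · intro h
    obtain ⟨w, hw⟩ := IsDiscreteValuationRing.exists_lift_of_le_one (A := P.ring) h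
    rw [← hw]
    exact w.2
  · intro h
    exact IsDedekindDomain.HeightOneSpectrum.valuation_le_one _ (⟨z, h⟩ : P.ring)

theorem valuation_lt_one_iff (P : Place K L) {z : L} :
    P.valuation z < 1 ↔ z ∈ P.ring.nonunits := by
  rw [ValuationSubring.mem_nonunits_iff_or, ← P.valuation_le_one_iff]
  by_cases hz : z = 0
  · simp [hz]
  · have : 0 < P.valuation z := by simp [zero_lt_iff, hz]
    simp [hz, inv_le_one₀ this]

theorem ring_injective : Function.Injective (Place.ring : Place K L → ValuationSubring L) := by
  rintro ⟨V, _, _⟩ ⟨W, _, _⟩ h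
  simpa using h

end Place

/-- Existence of places: if `I` is a proper ideal, not zero, of a `K`-subalgebra `A` of `L`, some
place is nonnegative on `A` and positive on `I`. -/
theorem exists_place (hfin : ∀ z : L, Transcendental K z → FiniteDimensional K⟮z⟯ L)
    {A : Subalgebra K L} {I : Ideal A} (hI : I ≠ ⊤) (hI0 : I ≠ ⊥) :
    ∃ P : Place K L, ∀ a ∈ I, P.valuation (a : L) < 1 := by
  obtain ⟨V, hAV, hIV⟩ := Ideal.image_subset_nonunits_valuationSubring (A := A.toSubring) I hI
  have hV : ∀ a : K, algebraMap K L a ∈ V := fun a => hAV (A.algebraMap_mem a)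
  obtain ⟨u, hu, hu0⟩ := Submodule.exists_mem_ne_zero_of_ne_bot hI0
  have hne : V ≠ ⊤ := by
    rintro rfl
    refine (ValuationSubring.mem_nonunits_iff_or _).1 (hIV ⟨u, hu, rfl⟩) |>.elim ?_ ?_
    · exact fun h => hu0 (Subtype.ext h)
    · exact fun h => h (ValuationSubring.mem_top _)
  exact ⟨⟨V, isDiscreteValuationRing_of_finiteDimensional hfin hV hne, hV⟩,
    fun a ha => (Place.valuation_lt_one_iff _).2 (hIV ⟨a, ha, rfl⟩)⟩

/-- A transcendental function has a zero. -/
theorem exists_valuation_lt_one (hfin : ∀ z : L, Transcendental K z → FiniteDimensional K⟮z⟯ L)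
    {z : L} (hz : Transcendental K z) : ∃ P : Place K L, P.valuation z < 1 := by
  let w : Algebra.adjoin K {z} := ⟨z, Algebra.self_mem_adjoin_singleton K z⟩
  have hI : Ideal.span {w} ≠ ⊤ := by
    rw [Ne, Ideal.span_singleton_eq_top, isUnit_iff_exists_inv]
    rintro ⟨⟨b, hb⟩, hzb⟩
    obtain ⟨p, rfl⟩ := (Algebra.adjoin_singleton_eq_range_aeval K z).le hb
    have h0 : Polynomial.aeval z (Polynomial.X * p - 1) = 0 := by
      rw [map_sub, map_mul, Polynomial.aeval_X, map_one, sub_eq_zero]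
      exact congrArg Subtype.val hzb
    have h1 := (transcendental_iff.1 hz) _ h0
    have := congrArg (Polynomial.eval 0) h1
    simp at this
  have hz0 : z ≠ 0 := by rintro rfl; exact hz isAlgebraic_zero
  obtain ⟨P, hP⟩ := exists_place hfin hI (by
    rw [Ne, Ideal.span_singleton_eq_bot]
    exact fun h => hz0 (congrArg Subtype.val h))
  exact ⟨P, hP w (Ideal.mem_span_singleton_self w)⟩

end ValuationRings

end PlaneCurve

namespace PlaneCurve

open IntermediateField

/-! ### Pole orders and degrees as dimensions of quotients of valuation rings. -/

section DVR

variable {K V : Type*} [Field K] [CommRing V] [IsDomain V] [IsDiscreteValuationRing V] [Algebra K V]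

/-- Induction along the exact sequence `0 → V/(ϖ^n) → V/(ϖ^(n+1)) → V/(ϖ) → 0`, whose first map is
multiplication by `ϖ`. -/
theorem finite_and_finrank_quotient_span_pow {ϖ : V} (hϖ : Irreducible ϖ)
    [Module.Finite K (IsLocalRing.ResidueField V)] (n : ℕ) :
    Module.Finite K (V ⧸ Ideal.span {ϖ ^ n}) ∧
      Module.finrank K (V ⧸ Ideal.span {ϖ ^ n}) =
        n * Module.finrank K (IsLocalRing.ResidueField V) := by
  let e : IsLocalRing.ResidueField V ≃ₗ[K] (V ⧸ Ideal.span {ϖ}) :=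
    (Ideal.quotientEquivAlgOfEq K hϖ.maximalIdeal_eq).toLinearEquiv
  have hfin1 : Module.Finite K (V ⧸ Ideal.span {ϖ}) := .equiv e
  induction n with
  | zero =>
    have : Subsingleton (V ⧸ Ideal.span {ϖ ^ 0}) :=
      Ideal.Quotient.subsingleton_iff.2 (by simp)
    exact ⟨inferInstance, by simp [Module.finrank_zero_of_subsingleton]⟩
  | succ n ih =>
    obtain ⟨hfin, hrank⟩ := ih
    let f : (V ⧸ Ideal.span {ϖ ^ n}) →ₗ[V] (V ⧸ Ideal.span {ϖ ^ (n + 1)}) :=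
      Submodule.mapQ _ _ (LinearMap.mulLeft V ϖ) (by
        intro z hz
        obtain ⟨w, rfl⟩ := Ideal.mem_span_singleton.1 hz
        exact Ideal.mem_span_singleton.2 ⟨w, by simp; ring⟩)
    let g : (V ⧸ Ideal.span {ϖ ^ (n + 1)}) →ₗ[V] (V ⧸ Ideal.span {ϖ}) :=
      Submodule.factor (Ideal.span_singleton_le_span_singleton.2 (dvd_pow_self _ n.succ_ne_zero))
    have hf : Function.Injective f := by
      rw [injective_iff_map_eq_zero]
      intro q hq
      obtain ⟨z, rfl⟩ := Submodule.Quotient.mk_surjective _ q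
      have hq' : ϖ * z ∈ Ideal.span {ϖ ^ (n + 1)} := (Submodule.Quotient.mk_eq_zero _).1 hq
      refine (Submodule.Quotient.mk_eq_zero _).2 (Ideal.mem_span_singleton.2 ?_)
      rw [Ideal.mem_span_singleton, pow_succ'] at hq'
      exact (mul_dvd_mul_iff_left hϖ.ne_zero).1 hq'
    have hg : Function.Surjective g := fun q => by
      obtain ⟨z, rfl⟩ := Submodule.Quotient.mk_surjective _ q
      exact ⟨Submodule.Quotient.mk z, rfl⟩
    have hfg : Function.Exact f g := by
      intro q
      obtain ⟨z, rfl⟩ := Submodule.Quotient.mk_surjective _ q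
      constructor
      · intro h
        have hz : z ∈ Ideal.span {ϖ} := (Submodule.Quotient.mk_eq_zero _).1 h
        obtain ⟨w, rfl⟩ := Ideal.mem_span_singleton.1 hz
        exact ⟨Submodule.Quotient.mk w, rfl⟩
      · rintro ⟨q, hq⟩
        obtain ⟨w, rfl⟩ := Submodule.Quotient.mk_surjective _ q
        rw [← hq]
        exact (Submodule.Quotient.mk_eq_zero _).2 (Ideal.mem_span_singleton.2 ⟨w, rfl⟩)
    have hex : Function.Exact (f.restrictScalars K) (g.restrictScalars K) := hfg
    have hfin' : Module.Finite K (V ⧸ Ideal.span {ϖ ^ (n + 1)}) := Module.Finite.of_exact hex hg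
    refine ⟨hfin', ?_⟩
    have h1 := LinearMap.finrank_range_add_finrank_ker (g.restrictScalars K)
    rw [LinearMap.exact_iff.1 hex, LinearMap.finrank_range_of_inj (f := f.restrictScalars K) hf,
      (LinearMap.range_eq_top (f := g.restrictScalars K)).2 hg, finrank_top, hrank,
      ← e.finrank_eq] at h1
    rw [← h1]
    ring

end DVR

namespace Place

variable {K L : Type*} [Field K] [Field L] [Algebra K L]

theorem valuation_irreducible (P : Place K L) {ϖ : P.ring} (hϖ : Irreducible ϖ) :
    P.valuation (ϖ : L) = WithZero.exp (-1 : ℤ) := by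
  have h := IsDedekindDomain.HeightOneSpectrum.intValuation_singleton
    (IsDiscreteValuationRing.maximalIdeal P.ring) hϖ.ne_zero hϖ.maximalIdeal_eq
  rw [← h]
  exact IsDedekindDomain.HeightOneSpectrum.valuation_of_algebraMap _ ϖ

theorem poleOrder_eq_zero_iff (P : Place K L) {x : L} : P.poleOrder x = 0 ↔ ¬ P.IsPole x := by
  rw [poleOrder, IsPole, Int.toNat_eq_zero]
  by_cases hx : x = 0
  · simp [hx]
  · rw [WithZero.log_le_iff_le_exp (by simpa using hx), WithZero.exp_zero, not_lt]

theorem isPole_iff (P : Place K L) {x : L} (hx : x ≠ 0) : P.IsPole x ↔ P.valuation x⁻¹ < 1 := by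
  rw [IsPole, map_inv₀, inv_lt_one₀ (by simp [zero_lt_iff, hx])]

theorem isPole_iff_notMem (P : Place K L) {x : L} : P.IsPole x ↔ x ∉ P.ring := by
  rw [IsPole, ← not_le, valuation_le_one_iff]

theorem finite_residueField
    (hfin : ∀ z : L, Transcendental K z → FiniteDimensional K⟮z⟯ L) (P : Place K L) :
    Module.Finite K (IsLocalRing.ResidueField P.ring) := by
  obtain ⟨ϖ, hϖ⟩ := IsDiscreteValuationRing.exists_irreducible P.ring
  have := hfin _ (transcendental_of_mem_nonunits P.algebraMap_mem
    (P.ring.coe_mem_nonunits_iff.2 hϖ.not_isUnit) (by simpa using hϖ.ne_zero))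
  have := finite_quotient_span (K := K) hϖ.ne_zero
  exact .equiv (Ideal.quotientEquivAlgOfEq K hϖ.maximalIdeal_eq).toLinearEquiv.symm

theorem degree_pos
    (hfin : ∀ z : L, Transcendental K z → FiniteDimensional K⟮z⟯ L) (P : Place K L) :
    0 < P.degree := by
  have := P.finite_residueField hfin
  exact Module.finrank_pos

/-- The coefficient of a place in the pole divisor of `t⁻¹`, times the degree of the place, is the
dimension of `V / (t)`, where `V` is the valuation ring of the place. -/
theorem finite_and_finrank_quotient_span
    (hfin : ∀ z : L, Transcendental K z → FiniteDimensional K⟮z⟯ L) (P : Place K L)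
    {t : P.ring} (ht : t ≠ 0) :
    Module.Finite K (P.ring ⧸ Ideal.span {t}) ∧
      Module.finrank K (P.ring ⧸ Ideal.span {t}) = P.poleOrder (t : L)⁻¹ * P.degree := by
  have := P.finite_residueField hfin
  obtain ⟨ϖ, hϖ⟩ := IsDiscreteValuationRing.exists_irreducible P.ring
  obtain ⟨n, u, rfl⟩ := IsDiscreteValuationRing.eq_unit_mul_pow_irreducible ht hϖ
  have hu : P.valuation ((u : P.ring) : L) = 1 := by
    refine le_antisymm (P.valuation_le_one_iff.2 u.1.2) (not_lt.1 fun h => ?_)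
    exact P.ring.coe_mem_nonunits_iff.1 (P.valuation_lt_one_iff.1 h) u.isUnit
  have hn : P.poleOrder ((u * ϖ ^ n : P.ring) : L)⁻¹ = n := by
    rw [poleOrder, map_inv₀, WithZero.log_inv]
    push_cast
    rw [map_mul, map_pow, hu, one_mul, P.valuation_irreducible hϖ, WithZero.log_pow,
      WithZero.log_exp]
    simp
  have hspan : Ideal.span {(u * ϖ ^ n : P.ring)} = Ideal.span {ϖ ^ n} :=
    Ideal.span_singleton_mul_left_unit u.isUnit _
  rw [hn, hspan]
  exact finite_and_finrank_quotient_span_pow hϖ n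

end Place

end PlaneCurve

namespace PlaneCurve

open Filter

/-! ### Weak approximation for places. -/

section Approximation

variable {K L : Type*} [Field K] [Field L] [Algebra K L]

namespace Place

/-- The absolute value `2 ^ (- v_P)` of a place. -/
noncomputable def absoluteValue (P : Place K L) : AbsoluteValue L ℝ :=
  (IsDiscreteValuationRing.maximalIdeal P.ring).adicAbv (K := L) (b := 2) one_lt_two

theorem absoluteValue_lt_one_iff (P : Place K L) {z : L} :
    P.absoluteValue z < 1 ↔ P.valuation z < 1 := by
  have h := (WithZeroMulInt.toNNReal_strictMono (e := 2) one_lt_two).lt_iff_lt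
    (a := P.valuation z) (b := 1)
  rw [map_one] at h
  rw [← h]
  exact NNReal.coe_lt_one

theorem one_lt_absoluteValue_iff (P : Place K L) {z : L} :
    1 < P.absoluteValue z ↔ 1 < P.valuation z := by
  have h := (WithZeroMulInt.toNNReal_strictMono (e := 2) one_lt_two).lt_iff_lt
    (a := 1) (b := P.valuation z)
  rw [map_one] at h
  rw [← h]
  exact NNReal.one_lt_coe

theorem absoluteValue_isNontrivial (P : Place K L) : P.absoluteValue.IsNontrivial := by
  obtain ⟨ϖ, hϖ⟩ := IsDiscreteValuationRing.exists_irreducible P.ring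
  refine ⟨ϖ, by simpa using hϖ.ne_zero, ne_of_lt ?_⟩
  rw [absoluteValue_lt_one_iff, P.valuation_lt_one_iff]
  exact P.ring.coe_mem_nonunits_iff.2 hϖ.not_isUnit

theorem eq_of_isEquiv {P Q : Place K L} (h : P.absoluteValue.IsEquiv Q.absoluteValue) : P = Q := by
  refine ring_injective (ValuationSubring.nonunits_injective ?_)
  ext z
  rw [← P.valuation_lt_one_iff, ← Q.valuation_lt_one_iff, ← absoluteValue_lt_one_iff,
    ← absoluteValue_lt_one_iff, h.lt_one_iff]

end Place

open scoped WithZero in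
theorem eventually_mul_pow_lt {a c γ : ℤᵐ⁰} (ha : a < 1) (hγ : γ ≠ 0) :
    ∀ᶠ N : ℕ in atTop, c * a ^ N < γ := by
  rcases eq_or_ne c 0 with rfl | hc
  · simp [zero_lt_iff, hγ]
  obtain ⟨n, hn⟩ := exists_pow_lt₀ ha (Units.mk0 (c⁻¹ * γ) (by simp [hc, hγ]))
  filter_upwards [eventually_ge_atTop n] with N hN
  have h1 : a ^ N < c⁻¹ * γ := (pow_le_pow_right_of_le_one' ha.le hN).trans_lt hn
  calc c * a ^ N < c * (c⁻¹ * γ) := (mul_lt_mul_iff_right₀ (zero_lt_iff.2 hc)).2 h1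
    _ = γ := mul_inv_cancel_left₀ hc γ

open scoped WithZero in
/-- Weak approximation. -/
theorem exists_forall_valuation_sub_lt {ι : Type*} [Finite ι] {P : ι → Place K L}
    (hP : Function.Injective P) (w : ι → L) {γ : ℤᵐ⁰} (hγ : γ ≠ 0) :
    ∃ z : L, ∀ i, (P i).valuation (z - w i) < γ := by
  classical
  have := Fintype.ofFinite ι
  have hex : ∀ i, ∃ a : L, 1 < (P i).valuation a ∧ ∀ j ≠ i, (P j).valuation a < 1 := by
    intro i
    obtain ⟨a, ha, ha'⟩ := AbsoluteValue.exists_one_lt_lt_one_pi_of_not_isEquiv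
      (fun i => (P i).absoluteValue_isNontrivial)
      (fun i j hij h => hij (hP (Place.eq_of_isEquiv h))) i
    exact ⟨a, (P i).one_lt_absoluteValue_iff.1 ha,
      fun j hj => (P j).absoluteValue_lt_one_iff.1 (ha' j hj)⟩
  choose a ha ha' using hex
  -- As `N` grows, `a i ^ N / (1 + a i ^ N)` tends to `1` at `P i`, where `a i` is large, and to `0`
  -- at the other places, where it is small.
  have hN : ∀ i, ∃ N : ℕ, ∀ j, (P j).valuation
      (w i * (a i ^ N / (1 + a i ^ N)) - if i = j then w j else 0) < γ := by
    intro i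
    refine Eventually.exists (f := atTop) (eventually_all.2 fun j => ?_)
    by_cases hij : i = j
    · subst hij
      have h1 : (P i).valuation (a i)⁻¹ < 1 := by
        rw [map_inv₀]; exact inv_lt_one_of_one_lt₀ (ha i)
      filter_upwards [eventually_mul_pow_lt (c := (P i).valuation (w i)) h1 hγ,
        eventually_gt_atTop 0] with N hN hN0
      have h2 : 1 < (P i).valuation (a i ^ N) := by
        rw [map_pow]; exact one_lt_pow₀ (ha i) hN0.ne'
      have h3 : (P i).valuation (1 + a i ^ N) = (P i).valuation (a i ^ N) :=
        Valuation.map_add_eq_of_lt_right _ ((map_one (P i).valuation).trans_lt h2)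
      have h4 : 1 + a i ^ N ≠ 0 := fun h => by
        rw [h, map_zero] at h3
        rw [← h3] at h2
        exact not_lt_zero h2
      have h5 : w i * (a i ^ N / (1 + a i ^ N)) - w i = -(w i / (1 + a i ^ N)) := by
        field_simp
        ring
      rw [if_pos rfl, h5, Valuation.map_neg, map_div₀, h3, div_eq_mul_inv, map_pow, ← inv_pow,
        ← map_inv₀]
      exact hN
    · filter_upwards [eventually_mul_pow_lt (c := (P j).valuation (w i)) (ha' i j (Ne.symm hij)) hγ,
        eventually_gt_atTop 0] with N hN hN0
      have h2 : (P j).valuation (a i ^ N) < 1 := by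
        rw [map_pow]; exact pow_lt_one₀ zero_le (ha' i j (Ne.symm hij)) hN0.ne'
      have h3 : (P j).valuation (1 + a i ^ N) = 1 := by
        rw [Valuation.map_add_eq_of_lt_left _ (h2.trans_eq (map_one (P j).valuation).symm),
          map_one]
      rw [if_neg hij, sub_zero, map_mul, map_div₀, h3, div_one, map_pow]
      exact hN
  choose N hN using hN
  refine ⟨∑ i, w i * (a i ^ N i / (1 + a i ^ N i)), fun j => ?_⟩
  have : ∑ i, w i * (a i ^ N i / (1 + a i ^ N i)) - w j =
      ∑ i, (w i * (a i ^ N i / (1 + a i ^ N i)) - if i = j then w j else 0) := by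
    simp [Finset.sum_sub_distrib]
  rw [this]
  exact Valuation.map_sum_lt _ hγ fun i _ => hN i j

end Approximation

end PlaneCurve

namespace PlaneCurve

open Filter IntermediateField

universe u

/-! ### Zeros of `t`: upper bound for their total degree, and functions with bounded poles. -/

section PoleDegree

variable {K : Type*} {L : Type u} [Field K] [Field L] [Algebra K L]

/-- The residues of `s * z` modulo `t i` at the places `P i`, for `z ∈ M`. -/
noncomputable def multiResidue {ι : Type*} (P : ι → Place K L) (t : ∀ i, (P i).ring) (s : L)
    (M : Submodule K L) (hM : ∀ z ∈ M, ∀ i, s * z ∈ (P i).ring) :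
    M →ₗ[K] ∀ i, (P i).ring ⧸ Ideal.span {t i} where
  toFun z i := Ideal.Quotient.mk _ ⟨s * z, hM z z.2 i⟩
  map_add' z w := by
    ext i
    rw [Pi.add_apply, ← map_add]
    congr 1
    exact Subtype.ext (mul_add s (z : L) w)
  map_smul' c z := by
    ext i
    rw [RingHom.id_apply, Pi.smul_apply, Algebra.smul_def,
      IsScalarTower.algebraMap_apply K (P i).ring, Ideal.Quotient.algebraMap_eq, ← map_mul]
    congr 1
    apply Subtype.ext
    change s * (c • (z : L)) = algebraMap K L c * (s * z)
    rw [Algebra.smul_def, mul_left_comm]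

theorem multiResidue_eq_zero_iff {ι : Type*} {P : ι → Place K L} {t : ∀ i, (P i).ring} {s : L}
    {M : Submodule K L} (hM : ∀ z ∈ M, ∀ i, s * z ∈ (P i).ring) (z : M) :
    multiResidue P t s M hM z = 0 ↔ ∀ i, ∃ w ∈ (P i).ring, s * z = t i * w := by
  rw [funext_iff]
  refine forall_congr' fun i => ?_
  refine (Ideal.Quotient.eq_zero_iff_mem.trans Ideal.mem_span_singleton).trans ?_
  constructor
  · rintro ⟨w, hw⟩
    exact ⟨w, w.2, congrArg Subtype.val hw⟩
  · rintro ⟨w, hw, h⟩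
    exact ⟨⟨w, hw⟩, Subtype.ext h⟩

theorem finrank_pi_quotient_span
    (hfin : ∀ z : L, Transcendental K z → FiniteDimensional K⟮z⟯ L) {ι : Type*} [Fintype ι]
    (P : ι → Place K L) {t : L} (ht : t ≠ 0) (hP : ∀ i, t ∈ (P i).ring) :
    Module.Finite K (∀ i, (P i).ring ⧸ Ideal.span {(⟨t, hP i⟩ : (P i).ring)}) ∧
      Module.finrank K (∀ i, (P i).ring ⧸ Ideal.span {(⟨t, hP i⟩ : (P i).ring)}) =
        ∑ i, (P i).poleOrder t⁻¹ * (P i).degree := by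
  have h := fun i => (P i).finite_and_finrank_quotient_span hfin (t := ⟨t, hP i⟩)
    (fun h => ht (congrArg Subtype.val h))
  have := fun i => (h i).1
  refine ⟨inferInstance, ?_⟩
  rw [Module.finrank_pi_fintype]
  exact Finset.sum_congr rfl fun i _ => (h i).2

/-- A partial sum of the degree of the pole divisor of `t⁻¹` is at most `[L : K(t)]`. -/
theorem sum_poleOrder_mul_degree_le
    (hfin : ∀ z : L, Transcendental K z → FiniteDimensional K⟮z⟯ L) {ι : Type*} [Fintype ι]
    {P : ι → Place K L} (hinj : Function.Injective P) {t : L} (ht : Transcendental K t)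
    (hP : ∀ i, (P i).valuation t < 1) :
    ∑ i, (P i).poleOrder t⁻¹ * (P i).degree ≤ Module.finrank K⟮t⟯ L := by
  have ht0 : t ≠ 0 := by rintro rfl; exact ht isAlgebraic_zero
  have := hfin t ht
  have hPt : ∀ i, t ∈ (P i).ring := fun i => (P i).valuation_le_one_iff.1 (hP i).le
  rw [← (finrank_pi_quotient_span hfin P ht0 hPt).2]
  let M : Submodule K L :=
    { carrier := {z | ∀ i, z ∈ (P i).ring}
      add_mem' := fun ha hb i => add_mem (ha i) (hb i)
      zero_mem' := fun i => zero_mem _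
      smul_mem' := fun c z hz i => by
        rw [Algebra.smul_def]; exact mul_mem ((P i).algebraMap_mem c) (hz i) }
  have hM : ∀ z ∈ M, ∀ i, 1 * z ∈ (P i).ring := fun z hz i => by rw [one_mul]; exact hz i
  refine (finite_and_finrank_le_of_ker_le ht0 (M := M) (fun z hz i => mul_mem (hPt i) (hz i))
    (multiResidue P (fun i => ⟨t, hPt i⟩) 1 M hM) ?_ ?_).2
  · intro q
    choose w hw using fun i => Ideal.Quotient.mk_surjective (q i)
    -- Approximation to within the least value of `t` makes `z - w i` divisible by `t` at every `P
    -- i`, so `z` has the prescribed residues.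
    obtain ⟨γ, hγ0, hγ⟩ : ∃ γ : WithZero (Multiplicative ℤ), γ ≠ 0 ∧
        ∀ i, γ ≤ (P i).valuation t := by
      rcases isEmpty_or_nonempty ι with _ | _
      · exact ⟨1, one_ne_zero, fun i => isEmptyElim i⟩
      · obtain ⟨i, hi⟩ := Finite.exists_min fun i => (P i).valuation t
        exact ⟨(P i).valuation t, by simpa using ht0, hi⟩
    obtain ⟨z, hz⟩ := exists_forall_valuation_sub_lt hinj (fun i => (w i : L)) hγ0
    have hz' : ∀ i, z - w i ∈ (P i).ring := fun i =>
      (P i).valuation_le_one_iff.1 (((hz i).trans_le (hγ i)).trans (hP i)).le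
    refine ⟨⟨z, fun i => by simpa using add_mem (hz' i) (w i).2⟩, funext fun i => ?_⟩
    rw [← hw i]
    refine Ideal.Quotient.eq.2 (Ideal.mem_span_singleton.2 ?_)
    have hdiv : t⁻¹ * (z - w i) ∈ (P i).ring := by
      have h0 : 0 < (P i).valuation t := by simp [zero_lt_iff, ht0]
      rw [← (P i).valuation_le_one_iff, map_mul, map_inv₀, inv_mul_le_iff₀ h0, mul_one]
      exact ((hz i).trans_le (hγ i)).le
    refine ⟨⟨_, hdiv⟩, Subtype.ext ?_⟩
    change 1 * z - w i = t * (t⁻¹ * (z - w i))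
    rw [one_mul, mul_inv_cancel_left₀ ht0]
  · intro z w hzw
    rw [multiResidue_eq_zero_iff]
    exact fun i => ⟨w, w.2 i, by rw [one_mul, hzw]⟩

/-- The functions `z` that are regular at the places where `t` is not positive, and such that
`t ^ k * z` is regular at the places `P i`. -/
def boundedFunctions {ι : Type*} (P : ι → Place K L) (t : L) (k : ℤ) : Submodule K L where
  carrier := {z | (∀ Q : Place K L, 1 ≤ Q.valuation t → z ∈ Q.ring) ∧
    ∀ i, t ^ k * z ∈ (P i).ring}
  add_mem' ha hb := ⟨fun Q hQ => add_mem (ha.1 Q hQ) (hb.1 Q hQ),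
    fun i => by rw [mul_add]; exact add_mem (ha.2 i) (hb.2 i)⟩
  zero_mem' := ⟨fun Q _ => zero_mem _, fun i => by rw [mul_zero]; exact zero_mem _⟩
  smul_mem' c z hz := by
    constructor
    · intro Q hQ
      rw [Algebra.smul_def]
      exact mul_mem (Q.algebraMap_mem c) (hz.1 Q hQ)
    · intro i
      rw [Algebra.smul_def, mul_left_comm]
      exact mul_mem ((P i).algebraMap_mem c) (hz.2 i)

/-- A nonzero element would vanish at every zero of `t` and have no poles. It cannot be algebraic,
since `t` has a zero and algebraic functions have none; it cannot be transcendental, since its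
inverse would have a zero. -/
theorem boundedFunctions_neg_one
    (hfin : ∀ z : L, Transcendental K z → FiniteDimensional K⟮z⟯ L) {ι : Type*}
    {P : ι → Place K L} {t : L} (ht : Transcendental K t)
    (hP : ∀ i, (P i).valuation t < 1)
    (hall : ∀ Q : Place K L, Q.valuation t < 1 → ∃ i, P i = Q) :
    boundedFunctions P t (-1) = ⊥ := by
  have ht0 : t ≠ 0 := by rintro rfl; exact ht isAlgebraic_zero
  rw [Submodule.eq_bot_iff]
  rintro z ⟨hz1, hz2⟩
  by_contra hz0
  have hlt : ∀ i, (P i).valuation z < 1 := fun i => by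
    have h0 : 0 < (P i).valuation t := by simp [zero_lt_iff, ht0]
    have := (P i).valuation_le_one_iff.2 (hz2 i)
    rw [zpow_neg_one, map_mul, map_inv₀, inv_mul_le_iff₀ h0, mul_one] at this
    exact this.trans_lt (hP i)
  by_cases hz : IsAlgebraic K z
  · obtain ⟨Q, hQ⟩ := exists_valuation_lt_one hfin ht
    obtain ⟨i, rfl⟩ := hall Q hQ
    exact transcendental_of_mem_nonunits (P i).algebraMap_mem
      ((P i).valuation_lt_one_iff.1 (hlt i)) hz0 hz
  · obtain ⟨Q, hQ⟩ := exists_valuation_lt_one hfin (z := z⁻¹) (fun h => hz (by simpa using h.inv))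
    rw [← Q.isPole_iff hz0, Place.IsPole] at hQ
    by_cases hQt : Q.valuation t < 1
    · obtain ⟨i, rfl⟩ := hall Q hQt
      exact hQ.not_gt (hlt i)
    · exact hQ.not_ge (Q.valuation_le_one_iff.2 (hz1 Q (not_lt.1 hQt)))

/-- Reducing `t ^ n * z` modulo `t` at the `P i` has its kernel in the preceding space, so each step
adds at most the degree of the zero divisor of `t`. The index is shifted so that `n = 0` is the zero
space. -/
theorem rank_boundedFunctions_le
    (hfin : ∀ z : L, Transcendental K z → FiniteDimensional K⟮z⟯ L) {ι : Type u} [Fintype ι]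
    {P : ι → Place K L} {t : L} (ht : Transcendental K t)
    (hP : ∀ i, (P i).valuation t < 1)
    (hall : ∀ Q : Place K L, Q.valuation t < 1 → ∃ i, P i = Q) (n : ℕ) :
    Module.rank K (boundedFunctions P t ((n : ℤ) - 1)) ≤
      (n * ∑ i, (P i).poleOrder t⁻¹ * (P i).degree : ℕ) := by
  have ht0 : t ≠ 0 := by rintro rfl; exact ht isAlgebraic_zero
  have hPt : ∀ i, t ∈ (P i).ring := fun i => (P i).valuation_le_one_iff.1 (hP i).le
  obtain ⟨hfinite, hrank⟩ := finrank_pi_quotient_span hfin P ht0 hPt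
  induction n with
  | zero =>
    rw [Nat.cast_zero, zero_sub, boundedFunctions_neg_one hfin ht hP hall]
    simp
  | succ n ih =>
    have hn : ((n + 1 : ℕ) : ℤ) - 1 = n := by push_cast; ring
    rw [hn]
    let φ := multiResidue P (fun i => ⟨t, hPt i⟩) (t ^ (n : ℤ)) (boundedFunctions P t n)
      (fun z hz i => hz.2 i)
    have hker : ∀ z : LinearMap.ker φ, (z : L) ∈ boundedFunctions P t ((n : ℤ) - 1) := by
      rintro ⟨z, hz⟩
      refine ⟨z.2.1, fun i => ?_⟩
      obtain ⟨w, hw, h⟩ := (multiResidue_eq_zero_iff _ z).1 hz i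
      rw [zpow_sub_one₀ ht0, mul_right_comm, h, mul_comm, inv_mul_cancel_left₀ ht0]
      exact hw
    let ψ : LinearMap.ker φ →ₗ[K] boundedFunctions P t ((n : ℤ) - 1) :=
      ((boundedFunctions P t n).subtype ∘ₗ (LinearMap.ker φ).subtype).codRestrict _ hker
    have hψ : Function.Injective ψ := fun a b hab =>
      Subtype.ext (Subtype.ext (congrArg (boundedFunctions P t ((n : ℤ) - 1)).subtype hab))
    have h1 := LinearMap.rank_range_add_rank_ker φ
    have h2 := (LinearMap.range φ).rank_le
    rw [← Module.finrank_eq_rank K (∀ i, _), hrank] at h2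
    rw [← h1, Nat.succ_mul, add_comm, Nat.cast_add]
    exact add_le_add ((LinearMap.rank_le_of_injective ψ hψ).trans ih) h2

end PoleDegree

end PlaneCurve

namespace PlaneCurve

open Filter IntermediateField

universe u

/-! ### The pole divisor of `x` has degree `[L : K(x)]`. -/

section PoleDegree

variable {K : Type*} {L : Type u} [Field K] [Field L] [Algebra K L]

theorem linearIndependent_pow_of_transcendental {E : Type*} [Field E] [Algebra K E] {x : E}
    (hx : Transcendental K x) : LinearIndependent K fun i : ℕ => x ^ i := by
  have h := (Polynomial.basisMonomials K).linearIndependent.map'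
    (Polynomial.aeval x).toLinearMap
    (LinearMap.ker_eq_bot.2 (transcendental_iff_injective.1 hx))
  have heq : (Polynomial.aeval x).toLinearMap ∘ Polynomial.basisMonomials K =
      fun i : ℕ => x ^ i := by
    ext i
    simp
  rwa [heq] at h

open algebraAdjoinAdjoin in
-- Denominators of a basis are cleared. Integrality over `K[x]` guarantees that the `u j` have poles
-- only at poles of `x`.
theorem exists_linearIndependent_isIntegral (x : L) [FiniteDimensional K⟮x⟯ L] :
    ∃ u : Fin (Module.finrank K⟮x⟯ L) → L, LinearIndependent K⟮x⟯ u ∧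
      ∀ j, IsIntegral (Algebra.adjoin K {x}) (u j) := by
  let b := Module.finBasis K⟮x⟯ L
  have halg : Algebra.IsAlgebraic (Algebra.adjoin K {x}) L :=
    .trans (Algebra.adjoin K {x}) K⟮x⟯ L
  choose d hd0 hd using fun j => (halg.isAlgebraic (b j)).exists_integral_multiple
  refine ⟨fun j => d j • b j, ?_, hd⟩
  have hd0' : ∀ j, algebraMap _ K⟮x⟯ (d j) ≠ 0 := fun j => by
    simpa using hd0 j
  have := b.linearIndependent.units_smul (fun j => Units.mk0 _ (hd0' j))
  exact this

theorem adjoin_inv_eq (x : L) : K⟮x⁻¹⟯ = K⟮x⟯ := by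
  refine le_antisymm ?_ ?_
  · exact adjoin_simple_le_iff.2 (inv_mem (mem_adjoin_simple_self K x))
  · rw [adjoin_simple_le_iff]
    simpa using inv_mem (mem_adjoin_simple_self K x⁻¹)

/-- If the `P i` are all the poles of `x`, then `[L : K(x)]` is at most the degree of the pole
divisor of `x`. -/
theorem finrank_le_sum_poleOrder_mul_degree
    (hfin : ∀ z : L, Transcendental K z → FiniteDimensional K⟮z⟯ L) {ι : Type u} [Fintype ι]
    {P : ι → Place K L} {x : L} (hx : Transcendental K x)
    (hP : ∀ i, (P i).IsPole x) (hall : ∀ Q : Place K L, Q.IsPole x → ∃ i, P i = Q) :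
    Module.finrank K⟮x⟯ L ≤ ∑ i, (P i).poleOrder x * (P i).degree := by
  have hx0 : x ≠ 0 := by rintro rfl; exact hx isAlgebraic_zero
  have := hfin x hx
  simp_rw [Place.isPole_iff _ hx0] at hP hall
  have ht : Transcendental K x⁻¹ := fun h => hx (by simpa using h.inv)
  have hrank := rank_boundedFunctions_le hfin ht hP hall
  rw [inv_inv] at hrank
  set r := ∑ i, (P i).poleOrder x * (P i).degree
  set n := Module.finrank K⟮x⟯ L
  obtain ⟨u, hu, hint⟩ := exists_linearIndependent_isIntegral (K := K) x
  have hreg : ∀ Q : Place K L, 1 ≤ Q.valuation x⁻¹ → x ∈ Q.ring := fun Q hQ => by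
    rw [← not_lt, ← Q.isPole_iff hx0, Q.isPole_iff_notMem, not_not] at hQ
    exact hQ
  have hureg : ∀ j, ∀ Q : Place K L, 1 ≤ Q.valuation x⁻¹ → u j ∈ Q.ring := by
    intro j Q hQ
    have hle : ∀ z ∈ Algebra.adjoin K {x}, z ∈ Q.ring := by
      intro z hz
      induction hz using Algebra.adjoin_induction with
      | mem y hy => rw [Set.mem_singleton_iff.1 hy]; exact hreg Q hQ
      | algebraMap a => exact Q.algebraMap_mem a
      | add _ _ _ _ h1 h2 => exact add_mem h1 h2
      | mul _ _ _ _ h1 h2 => exact mul_mem h1 h2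
    let : Algebra (Algebra.adjoin K {x}) Q.ring :=
      ((algebraMap (Algebra.adjoin K {x}) L).codRestrict Q.ring fun z => hle z z.2).toAlgebra
    have : IsScalarTower (Algebra.adjoin K {x}) Q.ring L := .of_algebraMap_eq fun _ => rfl
    obtain ⟨w, hw⟩ := IsIntegrallyClosed.isIntegral_iff.1 ((hint j).tower_top (A := Q.ring))
    rw [← hw]
    exact w.2
  -- One power `x⁻¹ ^ c` absorbs the poles of all the `u j` at all the `P i`.
  obtain ⟨c, hc⟩ : ∃ c : ℕ, ∀ i j, (P i).valuation (u j) * (P i).valuation x⁻¹ ^ c < 1 :=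
    Eventually.exists (f := atTop) (eventually_all.2 fun i => eventually_all.2 fun j =>
      eventually_mul_pow_lt (hP i) one_ne_zero)
  have hmem : ∀ k : ℕ, ∀ i ≤ k, ∀ j,
      x ^ i * u j ∈ boundedFunctions P x⁻¹ (((k + c + 1 : ℕ) : ℤ) - 1) := by
    intro k i hik j
    refine ⟨fun Q hQ => mul_mem (pow_mem (hreg Q hQ) i) (hureg j Q hQ), fun a => ?_⟩
    have hkc : ((k + c + 1 : ℕ) : ℤ) - 1 = ((k - i) + c + i : ℕ) := by
      omega
    have heq : (x⁻¹ : L) ^ (((k + c + 1 : ℕ) : ℤ) - 1) * (x ^ i * u j) =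
        x⁻¹ ^ (k - i) * (u j * x⁻¹ ^ c) := by
      rw [hkc, zpow_natCast, pow_add, pow_add]
      have : (x⁻¹ : L) ^ i * x ^ i = 1 := by rw [← mul_pow, inv_mul_cancel₀ hx0, one_pow]
      linear_combination (x⁻¹ ^ (k - i) * x⁻¹ ^ c * u j) * this
    rw [heq]
    refine mul_mem (pow_mem ((P a).valuation_le_one_iff.1 (hP a).le) _) ?_
    rw [← (P a).valuation_le_one_iff, map_mul, map_pow]
    exact (hc a j).le
  -- The products `x ^ i * u j` with `i ≤ k` are `(k + 1) * n` functions independent over `K` in a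
  -- space of dimension at most `(k + c + 1) * r`.
  have hbound : ∀ k : ℕ, (k + 1) * n ≤ (k + c + 1) * r := by
    intro k
    have hgen : Transcendental K (AdjoinSimple.gen K x) := fun h => hx (h.algebraMap (A := L))
    have hli := linearIndependent_smul ((linearIndependent_pow_of_transcendental hgen).comp
      (fun i : Fin (k + 1) => (i : ℕ)) Fin.val_injective) hu
    let v : Fin (k + 1) × Fin n → boundedFunctions P x⁻¹ (((k + c + 1 : ℕ) : ℤ) - 1) :=
      fun p => ⟨x ^ (p.1 : ℕ) * u p.2, hmem k p.1 (Nat.lt_succ_iff.1 p.1.2) p.2⟩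
    have hv : LinearIndependent K v := by
      refine LinearIndependent.of_comp (Submodule.subtype _) ?_
      exact hli
    have h1 := hv.cardinal_lift_le_rank
    have h2 := hrank (k + c + 1)
    have h3 := h1.trans (Cardinal.lift_le.2 h2)
    simp only [Cardinal.mk_fintype, Fintype.card_prod, Fintype.card_fin, Cardinal.lift_natCast] at h3
    exact_mod_cast h3
  by_contra! hlt
  -- If `r + 1 ≤ n`, then `k = r * c` is large enough: `(rc + 1)(r + 1)` exceeds `(rc + c + 1) r` by
  -- `1`.
  have h := hbound (r * c)
  have h' := Nat.mul_le_mul_left (r * c + 1) (Nat.succ_le_of_lt hlt)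
  nlinarith

/-- The pole divisor of a transcendental function `x` has degree `[L : K(x)]`. -/
theorem exists_isPoleDivisor_of_transcendental
    (hfin : ∀ z : L, Transcendental K z → FiniteDimensional K⟮z⟯ L) {x : L}
    (hx : Transcendental K x) :
    ∃ D : Place K L →₀ ℕ, IsPoleDivisor D x ∧ divisorDegree D = Module.finrank K⟮x⟯ L := by
  classical
  have hx0 : x ≠ 0 := by rintro rfl; exact hx isAlgebraic_zero
  have ht : Transcendental K x⁻¹ := fun h => hx (by simpa using h.inv)
  have hle : ∀ s : Finset (Place K L), (∀ P ∈ s, P.IsPole x) →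
      ∑ P ∈ s, P.poleOrder x * P.degree ≤ Module.finrank K⟮x⟯ L := by
    intro s hs
    have := sum_poleOrder_mul_degree_le hfin (P := fun P : s => P.1) Subtype.val_injective ht
      (fun P => (P.1.isPole_iff hx0).1 (hs P.1 P.2))
    rwa [inv_inv, adjoin_inv_eq, Finset.sum_coe_sort s fun P => P.poleOrder x * P.degree] at this
  -- Each pole contributes at least `1` to a sum bounded by `[L : K(x)]`.
  have hS : {P : Place K L | P.IsPole x}.Finite := by
    by_contra hinf
    obtain ⟨s, hs, hcard⟩ := Set.Infinite.exists_subset_card_eq hinf (Module.finrank K⟮x⟯ L + 1)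
    have h1 : s.card ≤ ∑ P ∈ s, P.poleOrder x * P.degree := by
      rw [Finset.card_eq_sum_ones]
      refine Finset.sum_le_sum fun P hP => Nat.mul_pos (Nat.pos_of_ne_zero fun h => ?_)
        (P.degree_pos hfin)
      exact P.poleOrder_eq_zero_iff.1 h (hs hP)
    have := hle s fun P hP => hs hP
    omega
  refine ⟨Finsupp.onFinset hS.toFinset (fun P => P.poleOrder x) fun P hP => ?_, fun P => rfl, ?_⟩
  · rw [Ne, P.poleOrder_eq_zero_iff, not_not] at hP
    simpa using hP
  · rw [divisorDegree, Finsupp.onFinset_sum _ fun P => zero_mul _]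
    refine le_antisymm (hle _ fun P hP => by simpa using hP) ?_
    have := finrank_le_sum_poleOrder_mul_degree hfin (P := fun P : hS.toFinset => P.1) hx
      (fun P => hS.mem_toFinset.1 P.2) (fun Q hQ => ⟨⟨Q, by simpa using hQ⟩, rfl⟩)
    rwa [Finset.sum_coe_sort hS.toFinset fun P => P.poleOrder x * P.degree] at this

theorem isPoleDivisor_zero_of_isAlgebraic {x : L} (hx : IsAlgebraic K x) :
    IsPoleDivisor (0 : Place K L →₀ ℕ) x := fun P => by
  rw [Finsupp.zero_apply, eq_comm, P.poleOrder_eq_zero_iff, P.isPole_iff_notMem, not_not]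
  exact mem_of_isAlgebraic P.algebraMap_mem hx

theorem IsPoleDivisor.unique {D D' : Place K L →₀ ℕ} {x : L} (h : IsPoleDivisor D x)
    (h' : IsPoleDivisor D' x) : D = D' :=
  Finsupp.ext fun P => (h P).trans (h' P).symm

end PoleDegree

end PlaneCurve

namespace PlaneCurve

open IntermediateField MvPolynomial

/-! ### Polynomial relations between the generators `x` and `y`. -/

section Plane

variable {K L : Type*} [Field K] [Field L] [Algebra K L] {f : MvPolynomial (Fin 2) K}

theorem degreeOf_le_of_dvd {σ : Type*} {g h : MvPolynomial σ K} (hgh : g ∣ h) (hh : h ≠ 0) (i : σ) :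
    g.degreeOf i ≤ h.degreeOf i := by
  obtain ⟨q, rfl⟩ := hgh
  rw [degreeOf_mul_eq (left_ne_zero_of_mul hh) (right_ne_zero_of_mul hh)]
  exact Nat.le_add_right _ _

theorem degreeOf_aeval_X_of_ne {σ : Type*} {i j : σ} (h : i ≠ j) (p : Polynomial K) :
    (Polynomial.aeval (X j : MvPolynomial σ K) p).degreeOf i = 0 := by
  induction p using Polynomial.induction_on' with
  | add p q hp hq =>
    rw [map_add]
    have := degreeOf_add_le i (Polynomial.aeval (X j : MvPolynomial σ K) p)
      (Polynomial.aeval (X j : MvPolynomial σ K) q)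
    rw [hp, hq] at this
    simpa using this
  | monomial n a =>
    rw [Polynomial.aeval_monomial, algebraMap_eq]
    have := degreeOf_C_mul_le (X j ^ n : MvPolynomial σ K) i a
    rw [degreeOf_X_pow_of_ne n h] at this
    simpa using this

theorem aeval_X_ne_zero {σ : Type*} (j : σ) {p : Polynomial K} (hp : p ≠ 0) :
    Polynomial.aeval (X j : MvPolynomial σ K) p ≠ 0 :=
  (transcendental_iff_injective.1 (transcendental_X K j)).ne_iff' (map_zero _) |>.2 hp

/-- If `f` divides every polynomial that vanishes at `(v 0, v 1)` and `v j` is algebraic, then `f`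
is a polynomial in `X j`. -/
theorem degreeOf_eq_zero_of_isAlgebraic {v : Fin 2 → L} (hdvd : ∀ g, aeval v g = 0 → f ∣ g)
    {i j : Fin 2} (hij : i ≠ j) (hj : IsAlgebraic K (v j)) : f.degreeOf i = 0 := by
  obtain ⟨p, hp0, hp⟩ := hj
  have h1 : aeval v (Polynomial.aeval (X j : MvPolynomial (Fin 2) K) p) = 0 := by
    rw [← Polynomial.aeval_algHom_apply, aeval_X, hp]
  have h2 := degreeOf_le_of_dvd (hdvd _ h1) (aeval_X_ne_zero j hp0) i
  rw [degreeOf_aeval_X_of_ne hij] at h2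
  exact Nat.le_zero.1 h2

theorem exists_degreeOf_ne_zero (hf : Irreducible f) : ∃ i, f.degreeOf i ≠ 0 := by
  by_contra! h
  have h0 : f.totalDegree = 0 := by
    rw [totalDegree_eq_zero_iff]
    intro m hm i
    have := monomial_le_degreeOf i hm
    rw [h i] at this
    exact Nat.le_zero.1 this
  rw [totalDegree_eq_zero_iff_eq_C] at h0
  by_cases hc : coeff 0 f = 0
  · rw [hc, C_0] at h0
    exact hf.ne_zero h0
  · refine hf.not_isUnit ?_
    rw [h0]
    exact (IsUnit.mk0 _ hc).map C

/-- A generic point of the curve is not algebraic. -/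
theorem exists_transcendental (hf : Irreducible f) {v : Fin 2 → L}
    (hdvd : ∀ g, aeval v g = 0 → f ∣ g) : ∃ j, Transcendental K (v j) := by
  obtain ⟨i, hi⟩ := exists_degreeOf_ne_zero hf
  obtain ⟨j, hj⟩ := exists_ne i
  exact ⟨j, fun h => hi (degreeOf_eq_zero_of_isAlgebraic hdvd hj.symm h)⟩

theorem krullDimLE_one_coordinateRing (hf0 : f ≠ 0) : Ring.KrullDimLE 1 (CoordinateRing f) := by
  have h := ringKrullDim_quotient_succ_le_of_nonZeroDivisor (mem_nonZeroDivisors_of_ne_zero hf0)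
  rw [MvPolynomial.ringKrullDim_of_isNoetherianRing, ringKrullDim_eq_zero_of_field, zero_add,
    Nat.card_eq_fintype_card, Fintype.card_fin] at h
  rw [Ring.krullDimLE_iff]
  have h2 : ((2 : ℕ) : WithBot ℕ∞) = (1 : ℕ) + 1 := by norm_num
  rw [h2] at h
  change ringKrullDim (CoordinateRing f) + 1 ≤ _ at h
  generalize ringKrullDim (CoordinateRing f) = a at h ⊢
  induction a with
  | bot => exact bot_le
  | coe a =>
    have h3 : a + 1 ≤ (1 : ℕ∞) + 1 := WithBot.coe_le_coe.1 h
    exact_mod_cast (ENat.add_le_add_iff_right ENat.one_ne_top).1 h3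

/-- Generators of the function field that satisfy `f` satisfy only the multiples of `f`. -/
theorem aeval_eq_zero_iff_dvd (hf : Irreducible f)
    [Algebra (CoordinateRing f) L] [IsScalarTower K (CoordinateRing f) L]
    [IsFractionRing (CoordinateRing f) L] {x y : L} (hgen : IntermediateField.adjoin K {x, y} = ⊤)
    (hxy : aeval ![x, y] f = 0) (g : MvPolynomial (Fin 2) K) :
    aeval ![x, y] g = 0 ↔ f ∣ g := by
  refine ⟨fun hg => ?_, fun ⟨q, hq⟩ => by rw [hq, map_mul, hxy, zero_mul]⟩
  by_contra hfg
  have hprime : (Ideal.span {f}).IsPrime :=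
    (Ideal.span_singleton_prime hf.ne_zero).2 hf.prime
  have : IsDomain (CoordinateRing f) := Ideal.Quotient.isDomain _
  have := krullDimLE_one_coordinateRing hf.ne_zero
  let φ : CoordinateRing f →ₐ[K] L := Ideal.Quotient.liftₐ _ (aeval ![x, y]) (by
    intro a ha
    obtain ⟨q, rfl⟩ := Ideal.mem_span_singleton.1 ha
    rw [map_mul, hxy, zero_mul])
  have hφ : ∀ p, φ (Ideal.Quotient.mk _ p) = aeval ![x, y] p := fun p => rfl
  -- In dimension at most one, a nonzero prime kernel is maximal. By the Nullstellensatz `x` and `y`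
  -- are then algebraic, so `L` is finite over `K`, although the class of `X` or of `Y` in `L` is
  -- transcendental.
  have hker : RingHom.ker φ ≠ ⊥ := fun h => by
    have : Ideal.Quotient.mk (Ideal.span {f}) g ∈ RingHom.ker φ := by
      rw [RingHom.mem_ker, hφ, hg]
    rw [h, Ideal.mem_bot, Ideal.Quotient.eq_zero_iff_dvd] at this
    exact hfg this
  have hmax : (RingHom.ker φ).IsMaximal := (RingHom.ker_isPrime φ).isMaximal_of_ne_bot hker
  let := Ideal.Quotient.field (RingHom.ker φ)
  have : Module.Finite K (CoordinateRing f ⧸ RingHom.ker φ) :=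
    finite_of_finite_type_of_isJacobsonRing _ _
  have halg : ∀ a, IsIntegral K (φ a) := fun a =>
    (Algebra.IsIntegral.isIntegral (R := K) (Ideal.Quotient.mk (RingHom.ker φ) a)).map
      (Ideal.kerLiftAlg φ)
  have hx : IsIntegral K x := by simpa [hφ] using halg (Ideal.Quotient.mk _ (X 0))
  have hy : IsIntegral K y := by simpa [hφ] using halg (Ideal.Quotient.mk _ (X 1))
  have hfin : FiniteDimensional K (IntermediateField.adjoin K {x, y}) :=
    finiteDimensional_adjoin (by
      rintro z (rfl | rfl)
      exacts [hx, hy])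
  rw [hgen] at hfin
  have hfin' : FiniteDimensional K L := .equiv topEquiv.toLinearEquiv
  obtain ⟨j, hj⟩ := exists_transcendental (L := L) hf
    (v := fun i => algebraMap (CoordinateRing f) L (Ideal.Quotient.mk _ (X i))) (by
      intro p hp
      rw [← Ideal.Quotient.eq_zero_iff_dvd]
      refine IsFractionRing.injective (CoordinateRing f) L ?_
      rw [map_zero, ← hp]
      have : ((IsScalarTower.toAlgHom K (CoordinateRing f) L).comp
          (Ideal.Quotient.mkₐ K (Ideal.span {f}))) = aeval fun i =>
            algebraMap (CoordinateRing f) L (Ideal.Quotient.mk _ (X i)) := by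
        ext i
        simp
      rw [← this]
      rfl)
  exact hj (Algebra.IsAlgebraic.isAlgebraic _)

end Plane

/-! ### Finiteness of `L` over `K(z)`. -/

section FunctionField

variable {K L : Type*} [Field K] [Field L] [Algebra K L] {f : MvPolynomial (Fin 2) K}

/-- A transcendence basis can be chosen inside `{x, y}`, and `f` forbids it to contain two elements.
-/
theorem trdeg_le_one (hf0 : f ≠ 0) {x y : L} (hgen : IntermediateField.adjoin K {x, y} = ⊤)
    (hxy : aeval ![x, y] f = 0) : Algebra.trdeg K L ≤ 1 := by
  have halg : Algebra.IsAlgebraic (Algebra.adjoin K {x, y}) L := by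
    open algebraAdjoinAdjoin in
    have h1 : Algebra.IsAlgebraic (Algebra.adjoin K {x, y}) (IntermediateField.adjoin K {x, y}) :=
      inferInstance
    have h2 : Algebra.IsAlgebraic (IntermediateField.adjoin K {x, y}) L := by
      rw [hgen]
      exact ⟨fun z => isAlgebraic_algebraMap (⟨z, mem_top⟩ : (⊤ : IntermediateField K L))⟩
    exact .trans _ (IntermediateField.adjoin K {x, y}) L
  obtain ⟨t, hts, ht⟩ := exists_isTranscendenceBasis_subset (R := K) ({x, y} : Set L)
  rw [← ht.cardinalMk_eq_trdeg]
  refine Cardinal.mk_le_one_iff_set_subsingleton.2 ?_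
  have hnot : ∀ hx : x ∈ t, ∀ hy : y ∈ t, x = y := by
    intro hx hy
    by_contra hne
    have h1 := ht.1.comp (![⟨x, hx⟩, ⟨y, hy⟩] : Fin 2 → t) (by
      intro i j hij
      fin_cases i <;> fin_cases j <;> simp_all)
    have h2 : (Subtype.val ∘ (![⟨x, hx⟩, ⟨y, hy⟩] : Fin 2 → t)) = ![x, y] := by
      ext i
      fin_cases i <;> rfl
    have h3 : AlgebraicIndependent K ![x, y] := by rw [← h2]; exact h1
    exact hf0 (h3.eq_zero_of_aeval_eq_zero f hxy)
  intro a ha b hb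
  rcases hts ha with rfl | rfl <;> rcases hts hb with rfl | rfl
  · rfl
  · exact hnot ha hb
  · exact (hnot hb ha).symm
  · rfl

/-- Supplies the hypothesis `hfin` of the theory of places: `z` is a transcendence basis, so `x` and
`y` are algebraic over `K(z)`. -/
theorem finiteDimensional_adjoin_of_transcendental (hf0 : f ≠ 0) {x y : L}
    (hgen : IntermediateField.adjoin K {x, y} = ⊤) (hxy : aeval ![x, y] f = 0) (z : L)
    (hz : Transcendental K z) : FiniteDimensional K⟮z⟯ L := by
  have hind : AlgebraicIndependent K (fun _ : Unit => z) :=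
    algebraicIndependent_unique_type_iff.2 hz
  have hbasis := hind.isTranscendenceBasis_of_lift_trdeg_le_of_finite
    (by simpa using trdeg_le_one hf0 hgen hxy)
  have halg := hbasis.isAlgebraic_field
  rw [Set.range_const] at halg
  have hfin : FiniteDimensional K⟮z⟯ (IntermediateField.adjoin K⟮z⟯ {x, y}) :=
    finiteDimensional_adjoin fun w _ => (Algebra.IsAlgebraic.isAlgebraic w).isIntegral
  have htop : IntermediateField.adjoin K⟮z⟯ {x, y} = ⊤ := by
    refine restrictScalars_injective K ?_
    rw [adjoin_adjoin_left, restrictScalars_top, eq_top_iff, ← hgen]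
    exact adjoin.mono _ _ _ Set.subset_union_right
  rw [htop] at hfin
  exact .equiv topEquiv.toLinearEquiv

end FunctionField

end PlaneCurve

namespace PlaneCurve

open IntermediateField MvPolynomial

/-! ### Degrees of the pole divisors of `x` and `y`. -/

section Degree

variable {K L : Type*} [Field K] [Field L] [Algebra K L] {f : MvPolynomial (Fin 2) K}

theorem aeval_eq_eval₂_finSuccEquiv (x y : L) (g : MvPolynomial (Fin 2) K) :
    aeval ![x, y] g = Polynomial.eval₂ (aeval fun _ : Fin 1 => y : MvPolynomial (Fin 1) K →ₐ[K] L)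
      x (finSuccEquiv K 1 g) := by
  let ψ : Polynomial (MvPolynomial (Fin 1) K) →+* L :=
    Polynomial.eval₂RingHom (aeval fun _ : Fin 1 => y : MvPolynomial (Fin 1) K →ₐ[K] L) x
  have h : ((aeval ![x, y] : MvPolynomial (Fin 2) K →ₐ[K] L) : MvPolynomial (Fin 2) K →+* L) =
      ψ.comp (finSuccEquiv K 1 : MvPolynomial (Fin 2) K →+* _) := by
    refine ringHom_ext (fun a => ?_) fun i => ?_
    · have : finSuccEquiv K 1 (C a) = Polynomial.C (C a) := by
        simp [finSuccEquiv_apply]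
      simp [ψ, this]
    · fin_cases i
      · simp [ψ, finSuccEquiv_X_zero]
      · have : finSuccEquiv K 1 (X 1) = Polynomial.C (X 0) := finSuccEquiv_X_succ (j := 0)
        simp [ψ, this]
  exact RingHom.congr_fun h g

theorem finrank_adjoin_simple_le {E : Type*} [Field E] [Algebra E L] {x : L} {p : Polynomial E}
    (hp : p ≠ 0) (hx : Polynomial.aeval x p = 0) (htop : E⟮x⟯ = ⊤) :
    FiniteDimensional E L ∧ Module.finrank E L ≤ p.natDegree := by
  have hint : IsIntegral E x := IsAlgebraic.isIntegral ⟨p, hp, hx⟩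
  have := adjoin.finiteDimensional hint
  have h1 := adjoin.finrank hint
  rw [htop] at this
  rw [htop, finrank_top'] at h1
  refine ⟨.equiv topEquiv.toLinearEquiv, ?_⟩
  rw [h1]
  exact Polynomial.natDegree_le_of_dvd (minpoly.dvd E x hx) hp

open algebraAdjoinAdjoin in
/-- The degree of the function field of `f = 0` over `K(y)` is the degree of `f` in `X`. -/
theorem finrank_adjoin_eq_degreeOf (hf0 : f ≠ 0) {x y : L}
    (hgen : IntermediateField.adjoin K {x, y} = ⊤)
    (hker : ∀ g, aeval ![x, y] g = 0 ↔ f ∣ g) (hy : Transcendental K y) :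
    Module.finrank K⟮y⟯ L = f.degreeOf 0 := by
  let α : MvPolynomial (Fin 1) K →ₐ[K] L := aeval fun _ : Fin 1 => y
  let β : MvPolynomial (Fin 1) K →ₐ[K] K⟮y⟯ := aeval fun _ : Fin 1 => AdjoinSimple.gen K y
  have hαβ : ∀ p, (β p : L) = α p := fun p => by
    have : α = (IntermediateField.val _).comp β := by
      ext i
      simp [α, β]
    rw [this]
    rfl
  have hα : Function.Injective α := (algebraicIndependent_unique_type_iff (ι := Fin 1)).2 hy
  have hβ : Function.Injective β := fun p q hpq => hα (by rw [← hαβ, ← hαβ, hpq])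
  have htop : K⟮y⟯⟮x⟯ = ⊤ := by
    refine restrictScalars_injective K ?_
    rw [adjoin_adjoin_left, restrictScalars_top, ← hgen, Set.union_comm]
    rfl
  have heval : ∀ p : Polynomial (MvPolynomial (Fin 1) K),
      Polynomial.aeval x (p.map β.toRingHom) = Polynomial.eval₂ α x p := fun p => by
    rw [Polynomial.aeval_def, Polynomial.eval₂_map]
    congr 1
    exact RingHom.ext hαβ
  obtain ⟨hfd, hle⟩ := finrank_adjoin_simple_le (E := K⟮y⟯) (x := x)
    (p := (finSuccEquiv K 1 f).map β.toRingHom)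
    (by
      rw [Ne, Polynomial.map_eq_zero_iff hβ]
      simpa using hf0)
    (by
      rw [heval, ← aeval_eq_eval₂_finSuccEquiv]
      exact (hker f).2 dvd_rfl) htop
  rw [Polynomial.natDegree_map_eq_of_injective hβ, natDegree_finSuccEquiv] at hle
  refine le_antisymm hle ?_
  -- A relation, with coefficients in `K[y]`, comes from a polynomial of `X`-degree less than `deg_X
  -- f` that `f` divides, which must be zero.
  have hli : LinearIndependent K⟮y⟯ fun i : Fin (f.degreeOf 0) => x ^ (i : ℕ) := by
    rw [← LinearIndependent.iff_fractionRing (Algebra.adjoin K {y}) K⟮y⟯,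
      Fintype.linearIndependent_iff]
    intro c hc
    have hsurj : ∀ a : Algebra.adjoin K {y}, ∃ p, α p = a := fun a => by
      obtain ⟨q, hq⟩ := (Algebra.adjoin_singleton_eq_range_aeval K y).le a.2
      refine ⟨Polynomial.aeval (X 0) q, ?_⟩
      rw [← Polynomial.aeval_algHom_apply, ← hq]
      simp [α]
    choose p hp using fun i => hsurj (c i)
    let q : Polynomial (MvPolynomial (Fin 1) K) :=
      ∑ i : Fin (f.degreeOf 0), Polynomial.C (p i) * Polynomial.X ^ (i : ℕ)
    have hq0 : q = 0 := by
      by_contra hq0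
      have hdvd : f ∣ (finSuccEquiv K 1).symm q := by
        rw [← hker, aeval_eq_eval₂_finSuccEquiv, AlgEquiv.apply_symm_apply,
          Polynomial.eval₂_finsetSum, ← hc]
        refine Finset.sum_congr rfl fun i _ => ?_
        rw [Polynomial.eval₂_mul, Polynomial.eval₂_C, Polynomial.eval₂_X_pow]
        change α (p i) * _ = _
        rw [hp i]
        rfl
      have h1 := degreeOf_le_of_dvd hdvd (by simpa using hq0) 0
      rw [← natDegree_finSuccEquiv ((finSuccEquiv K 1).symm q), AlgEquiv.apply_symm_apply] at h1
      have h2 : q.degree < (f.degreeOf 0 : ℕ) := Polynomial.degree_sum_fin_lt p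
      have := (Polynomial.natDegree_lt_iff_degree_lt hq0).2 h2
      omega
    intro i
    have hpi : p i = 0 := by
      have : q.coeff i = p i := by
        simp [q, Polynomial.coeff_X_pow, Fin.val_inj]
      rw [← this, hq0, Polynomial.coeff_zero]
    exact Subtype.ext (by rw [← hp i, hpi, map_zero]; rfl)
  simpa using hli.fintype_card_le_finrank

/-- The pole divisor of `y` has degree `deg_X f`. -/
theorem exists_isPoleDivisor_snd (hf0 : f ≠ 0) {x y : L}
    (hgen : IntermediateField.adjoin K {x, y} = ⊤)
    (hker : ∀ g, aeval ![x, y] g = 0 ↔ f ∣ g) :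
    ∃ D : Place K L →₀ ℕ, IsPoleDivisor D y ∧ divisorDegree D = f.degreeOf 0 := by
  by_cases hy : Transcendental K y
  · rw [← finrank_adjoin_eq_degreeOf hf0 hgen hker hy]
    exact exists_isPoleDivisor_of_transcendental
      (finiteDimensional_adjoin_of_transcendental hf0 hgen ((hker f).2 dvd_rfl)) hy
  -- An algebraic `y` has no poles, and then `f` divides a nonzero polynomial in `Y` alone, so both
  -- sides are `0`.
  · have hy' : IsAlgebraic K y := not_not.1 hy
    refine ⟨0, isPoleDivisor_zero_of_isAlgebraic hy', ?_⟩
    rw [degreeOf_eq_zero_of_isAlgebraic (v := ![x, y]) (fun g => (hker g).1) zero_ne_one hy']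
    rfl

/-- The pole divisor of `x` has degree `deg_Y f`. -/
theorem exists_isPoleDivisor_fst (hf0 : f ≠ 0) {x y : L}
    (hgen : IntermediateField.adjoin K {x, y} = ⊤)
    (hker : ∀ g, aeval ![x, y] g = 0 ↔ f ∣ g) :
    ∃ D : Place K L →₀ ℕ, IsPoleDivisor D x ∧ divisorDegree D = f.degreeOf 1 := by
  let e : MvPolynomial (Fin 2) K ≃ₐ[K] MvPolynomial (Fin 2) K := renameEquiv K (Equiv.swap 0 1)
  have he : ∀ g, e (e g) = g := fun g => by
    change rename _ (rename _ g) = g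
    rw [rename_rename]
    simp [← Equiv.coe_trans]
  have hdeg : (e f).degreeOf 0 = f.degreeOf 1 := by
    have := degreeOf_rename_of_injective (p := f) (Equiv.swap (0 : Fin 2) 1).injective 1
    rwa [Equiv.swap_apply_right] at this
  rw [← hdeg]
  refine exists_isPoleDivisor_snd (x := y) (y := x) (by simpa using hf0)
    (by rwa [Set.pair_comm]) fun g => ?_
  have h1 : aeval ![y, x] g = aeval ![x, y] (e g) := by
    change _ = aeval _ (rename _ g)
    rw [aeval_rename]
    congr 2
    ext i
    fin_cases i <;> simp
  rw [h1, hker]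
  exact ⟨fun h => by simpa [he] using map_dvd e h, fun h => by simpa [he] using map_dvd e h⟩

end Degree

end PlaneCurve

namespace PlaneCurve

open IntermediateField MvPolynomial

/-! ### Common poles and the corner term of `f`. -/

section CommonPoles

variable {K : Type*} [Field K]

/-- The corner of the smallest box containing the exponents of `f`. -/
noncomputable def multidegree {σ : Type*} [Finite σ] (f : MvPolynomial σ K) : σ →₀ ℕ :=
  Finsupp.equivFunOnFinite.symm fun i => f.degreeOf i

theorem le_multidegree {σ : Type*} [Finite σ] {f : MvPolynomial σ K} {s : σ →₀ ℕ}
    (hs : s ∈ f.support) : s ≤ multidegree f := fun i => monomial_le_degreeOf i hs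

/-- If the exponents of `g` lie in a box whose corner is an exponent of `g`, every factor of `g` has
the same property. -/
theorem coeff_multidegree_ne_zero_of_dvd {σ : Type*} [Finite σ] {f g : MvPolynomial σ K}
    (hfg : f ∣ g) {N : σ →₀ ℕ} (hN : ∀ s ∈ g.support, s ≤ N) (hgN : coeff N g ≠ 0) :
    coeff (multidegree f) f ≠ 0 := by
  classical
  obtain ⟨q, rfl⟩ := hfg
  have hg0 : f * q ≠ 0 := fun h => hgN (by rw [h, coeff_zero])
  -- Partial degrees add under multiplication, so exponents of `f` and `q` with sum `N` must both be
  -- maximal in every variable.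
  have hdeg : ∀ i, f.degreeOf i + q.degreeOf i ≤ N i := fun i => by
    rw [← degreeOf_mul_eq (left_ne_zero_of_mul hg0) (right_ne_zero_of_mul hg0), degreeOf_le_iff]
    exact fun s hs => hN s hs i
  rw [coeff_mul] at hgN
  obtain ⟨⟨a, b⟩, hab, hne⟩ := Finset.exists_ne_zero_of_sum_ne_zero hgN
  rw [Finset.HasAntidiagonal.mem_antidiagonal] at hab
  have ha := left_ne_zero_of_mul hne
  have hb := right_ne_zero_of_mul hne
  have : a = multidegree f := by
    ext i
    have h1 := monomial_le_degreeOf i (mem_support_iff.2 ha)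
    have h2 := monomial_le_degreeOf i (mem_support_iff.2 hb)
    have h3 := hdeg i
    have h4 : a i + b i = N i := by rw [← hab]; rfl
    have h5 : multidegree f i = f.degreeOf i := rfl
    simp only at h1 h2
    omega
  rw [← this]
  exact ha

/-- The polynomial `X ^ N * h(1 / X)`. -/
noncomputable def reciprocal {σ : Type*} (N : σ →₀ ℕ) (h : MvPolynomial σ K) : MvPolynomial σ K :=
  ∑ s ∈ h.support, monomial (N - s) (h.coeff s)

theorem le_of_mem_support_reciprocal {σ : Type*} {N : σ →₀ ℕ} {h : MvPolynomial σ K} :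
    ∀ s ∈ (reciprocal N h).support, s ≤ N := by
  classical
  intro s hs
  obtain ⟨t, _, ht⟩ := Finset.mem_biUnion.1 (support_sum hs)
  rw [Finset.mem_singleton.1 (support_monomial_subset ht)]
  exact tsub_le_self

theorem coeff_reciprocal {σ : Type*} {N : σ →₀ ℕ} {h : MvPolynomial σ K}
    (hN : ∀ s ∈ h.support, s ≤ N) : coeff N (reciprocal N h) = coeff 0 h := by
  classical
  rw [reciprocal, coeff_sum]
  simp only [coeff_monomial]
  rw [Finset.sum_eq_single 0]
  · simp
  · intro s hs hs0
    refine if_neg fun h' => hs0 ?_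
    have := tsub_add_cancel_of_le (hN s hs)
    rw [h'] at this
    simpa using this
  · intro h0
    simpa using h0

variable {L : Type*} [Field L] [Algebra K L]

theorem aeval_reciprocal {σ : Type*} [Fintype σ] {N : σ →₀ ℕ} {h : MvPolynomial σ K}
    (hN : ∀ s ∈ h.support, s ≤ N) {v : σ → L} (hv : ∀ i, v i ≠ 0) :
    aeval v (reciprocal N h) = (∏ i, v i ^ N i) * aeval (fun i => (v i)⁻¹) h := by
  rw [reciprocal, map_sum, aeval_def (fun i => (v i)⁻¹), eval₂_eq', Finset.mul_sum]
  refine Finset.sum_congr rfl fun s hs => ?_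
  rw [aeval_monomial, mul_left_comm, ← Finset.prod_mul_distrib,
    Finsupp.prod_fintype _ _ fun i => pow_zero _]
  congr 1
  refine Finset.prod_congr rfl fun i _ => ?_
  have hsi : s i ≤ N i := hN s hs i
  rw [Finsupp.tsub_apply, pow_sub₀ _ (hv i) hsi, inv_pow]

variable {f : MvPolynomial (Fin 2) K}

/-- If `X ^ m * Y ^ l`, with `m = deg_X f` and `l = deg_Y f`, is not a term of `f`, then the
coordinate functions have a common pole. -/
theorem exists_common_pole (hfin : ∀ z : L, Transcendental K z → FiniteDimensional K⟮z⟯ L)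
    {v : Fin 2 → L} (hdvd : ∀ g, aeval v g = 0 → f ∣ g) (hf : coeff (multidegree f) f = 0) :
    ∃ P : Place K L, ∀ i, P.IsPole (v i) := by
  -- If `v i = 0`, then `f` divides `X i`, which has a corner term.
  have hv : ∀ i, v i ≠ 0 := fun i hi => by
    refine coeff_multidegree_ne_zero_of_dvd (hdvd (X i) (by rw [aeval_X, hi]))
      (N := Finsupp.single i 1) (fun s hs => ?_) (by simp) hf
    rw [support_X, Finset.mem_singleton] at hs
    exact hs.le
  let φ : MvPolynomial (Fin 2) K →ₐ[K] L := aeval fun i => (v i)⁻¹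
  let w : Fin 2 → φ.range := fun i => ⟨(v i)⁻¹, X i, by simp [φ]⟩
  have hI : Ideal.span (Set.range w) ≠ ⊤ := by
    intro h
    obtain ⟨c, hc⟩ := (Ideal.mem_span_range_iff_exists_fun (v := w)).1
      ((Ideal.eq_top_iff_one _).1 h)
    choose p hp using fun i => (c i).2
    -- Lifting `1 = ∑ c i * w i` to polynomials gives a relation between the inverses with constant
    -- term `1`; this constant becomes the corner coefficient of its reciprocal.
    let g : MvPolynomial (Fin 2) K := 1 - ∑ i, p i * X i
    have hg0 : coeff 0 g = 1 := by
      simp [g, coeff_mul_X']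
    have hg : φ g = 0 := by
      have h1 := congrArg (Subtype.val : φ.range → L) hc
      rw [map_sub, map_one, map_sum, sub_eq_zero, ← OneMemClass.coe_one φ.range, ← h1]
      push_cast
      refine Finset.sum_congr rfl fun i _ => ?_
      rw [map_mul]
      congr 1
      · exact (hp i).symm
      · simp [φ, w]
    refine coeff_multidegree_ne_zero_of_dvd (hdvd (reciprocal (multidegree g) g) ?_)
      le_of_mem_support_reciprocal ?_ hf
    · rw [aeval_reciprocal (fun s => le_multidegree) hv]
      exact mul_eq_zero_of_right _ hg
    · rw [coeff_reciprocal fun s => le_multidegree, hg0]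
      exact one_ne_zero
  obtain ⟨P, hP⟩ := exists_place hfin hI (fun h => by
    have h0 : w 0 = 0 := by
      rw [← Ideal.mem_bot, ← h]
      exact Ideal.subset_span ⟨0, rfl⟩
    exact inv_ne_zero (hv 0) (congrArg Subtype.val h0))
  exact ⟨P, fun i => (P.isPole_iff (hv i)).2 (hP (w i) (Ideal.subset_span ⟨i, rfl⟩))⟩

theorem Place.valuation_algebraMap (P : Place K L) {a : K} (ha : a ≠ 0) :
    P.valuation (algebraMap K L a) = 1 := by
  refine le_antisymm (P.valuation_le_one_iff.2 (P.algebraMap_mem a)) ?_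
  have h := P.valuation_le_one_iff.2 (P.algebraMap_mem a⁻¹)
  have h0 : 0 < P.valuation (algebraMap K L a) := by simp [zero_lt_iff, ha]
  rwa [map_inv₀, map_inv₀, inv_le_one₀ h0] at h

/-- At a common pole of the coordinate functions, the term `X ^ m * Y ^ l` of `f`, with `m = deg_X f`
and `l = deg_Y f`, would dominate all the others. -/
theorem coeff_multidegree_eq_zero_of_isPole {v : Fin 2 → L} (hv : aeval v f = 0) {P : Place K L}
    (hP : ∀ i, P.IsPole (v i)) : coeff (multidegree f) f = 0 := by
  classical
  by_contra hne
  have hterm : ∀ s ∈ f.support, P.valuation (algebraMap K L (coeff s f) * ∏ i, v i ^ s i) =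
      ∏ i, P.valuation (v i) ^ s i := fun s hs => by
    rw [map_mul, P.valuation_algebraMap (mem_support_iff.1 hs), one_mul, map_prod]
    simp only [map_pow]
  have hmem : multidegree f ∈ f.support := mem_support_iff.2 hne
  have hlt : ∀ s ∈ f.support.erase (multidegree f),
      ∏ i, P.valuation (v i) ^ s i < ∏ i, P.valuation (v i) ^ (multidegree f) i := by
    intro s hs
    obtain ⟨hne, hs⟩ := Finset.mem_erase.1 hs
    have hle := le_multidegree hs
    obtain ⟨j, hj⟩ : ∃ j, s j ≠ multidegree f j := by
      by_contra! h
      exact hne (Finsupp.ext h)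
    refine Finset.prod_lt_prod (fun i _ => pow_pos (zero_lt_one.trans (hP i)) _)
      (fun i _ => pow_le_pow_right₀ (hP i).le (hle i)) ⟨j, Finset.mem_univ j, ?_⟩
    exact pow_lt_pow_right₀ (hP j) (lt_of_le_of_ne (hle j) hj)
  rw [aeval_def, eval₂_eq', ← Finset.add_sum_erase _ _ hmem] at hv
  have h0 : P.valuation (algebraMap K L (coeff (multidegree f) f) *
      ∏ i, v i ^ (multidegree f) i) ≠ 0 := by
    rw [hterm _ hmem]
    exact Finset.prod_ne_zero_iff.2 fun i _ => pow_ne_zero _ (zero_lt_one.trans (hP i)).ne'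
  have hsum : P.valuation (∑ s ∈ f.support.erase (multidegree f),
      algebraMap K L (coeff s f) * ∏ i, v i ^ s i) <
      P.valuation (algebraMap K L (coeff (multidegree f) f) * ∏ i, v i ^ (multidegree f) i) := by
    refine Valuation.map_sum_lt _ h0 fun s hs => ?_
    rw [hterm s (Finset.mem_of_mem_erase hs), hterm _ hmem]
    exact hlt s hs
  rw [add_eq_zero_iff_eq_neg'.1 hv, Valuation.map_neg] at hsum
  exact lt_irrefl _ hsum

end CommonPoles

end PlaneCurve

namespace PlaneCurve

open IntermediateField MvPolynomial

/-! ### Multiplicities at `O₁` and `O₂`. -/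

section Multiplicity

variable {K : Type*} [Field K]

/-- Distinct exponents prevent cancellation, so the order is the least degree that occurs. -/
theorem order_sum_monomial {σ ι : Type*} [Finite σ] {S : Finset ι} {e : ι → σ →₀ ℕ}
    (he : Set.InjOn e S) {c : ι → K} (hc : ∀ s ∈ S, c s ≠ 0) {n : ℕ}
    (hex : ∃ s ∈ S, (e s).degree = n) (hle : ∀ s ∈ S, n ≤ (e s).degree) :
    ((∑ s ∈ S, monomial (e s) (c s) : MvPolynomial σ K) : MvPowerSeries σ K).order = n := by
  classical
  refine MvPowerSeries.order_eq_nat.2 ⟨?_, fun d hd => ?_⟩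
  · obtain ⟨s, hs, hn⟩ := hex
    refine ⟨e s, ?_, hn⟩
    rw [MvPolynomial.coeff_coe, coeff_sum, Finset.sum_eq_single_of_mem s hs]
    · simpa using hc s hs
    · intro t ht hts
      rw [coeff_monomial, if_neg fun h => hts (he ht hs h)]
  · rw [MvPolynomial.coeff_coe, coeff_sum]
    refine Finset.sum_eq_zero fun s hs => ?_
    rw [coeff_monomial, if_neg]
    rintro rfl
    exact absurd (hle s hs) (not_le.2 hd)

theorem exists_mem_support_eq_degreeOf {σ : Type*} {f : MvPolynomial σ K} (hf : f ≠ 0) (i : σ) :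
    ∃ s ∈ f.support, s i = f.degreeOf i := by
  classical
  obtain ⟨s, hs, h⟩ := Finset.exists_mem_eq_sup f.support (support_nonempty.2 hf) fun m => m i
  exact ⟨s, hs, by rw [degreeOf_eq_sup, h]⟩

theorem add_le_totalDegree {f : MvPolynomial (Fin 2) K} {s : Fin 2 →₀ ℕ} (hs : s ∈ f.support) :
    s 0 + s 1 ≤ f.totalDegree := by
  have := le_totalDegree hs
  rwa [Finsupp.sum_fintype _ _ (fun _ => rfl), Fin.sum_univ_two] at this

/-- The exponent `(i, j)` of two variables. -/
noncomputable def exponent (i j : ℕ) : Fin 2 →₀ ℕ := Finsupp.equivFunOnFinite.symm ![i, j]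

theorem exponent_apply_zero (i j : ℕ) : exponent i j 0 = i := rfl

theorem exponent_apply_one (i j : ℕ) : exponent i j 1 = j := rfl

theorem exponent_degree (i j : ℕ) : (exponent i j).degree = i + j := by
  rw [Finsupp.degree_eq_sum, Fin.sum_univ_two, exponent_apply_zero, exponent_apply_one]

theorem monomial_exponent (i j : ℕ) (a : K) :
    monomial (exponent i j) a = C a * (X 0 ^ i * X 1 ^ j) := by
  rw [monomial_eq, Finsupp.prod_fintype _ _ fun i => pow_zero _, Fin.prod_univ_two,
    exponent_apply_zero, exponent_apply_one]

/-- Setting `X = 1` turns `X ^ i Y ^ j Z ^ (d - i - j)` into a term of degree `d - i`, least when `i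
= deg_X f`. Different terms stay different because `d` is fixed. -/
theorem multiplicity_O₁ {f : MvPolynomial (Fin 2) K} (hf : f ≠ 0) :
    multiplicity (homogenization f) (O₁ K) = (f.totalDegree - f.degreeOf 0 : ℕ) := by
  have hchart : chartIndex (![1, 0, 0] : Fin 3 → K) = 0 := by simp [chartIndex]
  have heq : localEquation (homogenization f) (![1, 0, 0] : Fin 3 → K) 0 =
      ∑ s ∈ f.support, monomial (exponent (s 1) (f.totalDegree - s 0 - s 1)) (f.coeff s) := by
    rw [localEquation, homogenization, map_sum]
    refine Finset.sum_congr rfl fun s _ => ?_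
    have h1 : (Fin.insertNth (α := fun _ => MvPolynomial (Fin 2) K) (0 : Fin 3) 1 fun j : Fin 2 =>
        X j + C ((![1, 0, 0] : Fin 3 → K) (Fin.succAbove 0 j) / (![1, 0, 0] : Fin 3 → K) 0)) =
        ![1, X 0, X 1] := by
      ext1 j
      fin_cases j
      · simp
      · simp
      · change X 1 + C ((0 : K) / 1) = X 1
        simp
    rw [h1, monomial_exponent]
    simp
  change (localEquation (homogenization f) ![1, 0, 0] (chartIndex ![1, 0, 0]) :
    MvPowerSeries (Fin 2) K).order = _
  rw [hchart, heq]
  have hdeg : ∀ s ∈ f.support, (exponent (s 1) (f.totalDegree - s 0 - s 1)).degree =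
      f.totalDegree - s 0 := fun s hs => by
    have := add_le_totalDegree hs
    rw [exponent_degree]
    omega
  refine order_sum_monomial (fun s hs t ht hst => ?_) (fun s hs => mem_support_iff.1 hs) ?_
    fun s hs => ?_
  · have h0 := DFunLike.congr_fun hst 0
    have h1 := DFunLike.congr_fun hst 1
    simp only [exponent_apply_zero, exponent_apply_one] at h0 h1
    have h2 := add_le_totalDegree hs
    have h3 := add_le_totalDegree ht
    ext i
    fin_cases i
    · change s 0 = t 0
      omega
    · exact h0
  · obtain ⟨s, hs, h⟩ := exists_mem_support_eq_degreeOf hf 0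
    exact ⟨s, hs, by rw [hdeg s hs, h]⟩
  · rw [hdeg s hs]
    have := monomial_le_degreeOf 0 hs
    omega

theorem multiplicity_O₂ {f : MvPolynomial (Fin 2) K} (hf : f ≠ 0) :
    multiplicity (homogenization f) (O₂ K) = (f.totalDegree - f.degreeOf 1 : ℕ) := by
  have hchart : chartIndex (![0, 1, 0] : Fin 3 → K) = 1 := by simp [chartIndex]
  have heq : localEquation (homogenization f) (![0, 1, 0] : Fin 3 → K) 1 =
      ∑ s ∈ f.support, monomial (exponent (s 0) (f.totalDegree - s 0 - s 1)) (f.coeff s) := by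
    rw [localEquation, homogenization, map_sum]
    refine Finset.sum_congr rfl fun s _ => ?_
    have h1 : (Fin.insertNth (α := fun _ => MvPolynomial (Fin 2) K) (1 : Fin 3) 1 fun j : Fin 2 =>
        X j + C ((![0, 1, 0] : Fin 3 → K) (Fin.succAbove 1 j) / (![0, 1, 0] : Fin 3 → K) 1)) =
        ![X 0, 1, X 1] := by
      ext1 j
      fin_cases j
      · change Fin.insertNth (α := fun _ => MvPolynomial (Fin 2) K) (1 : Fin 3) _ _
          (Fin.succAbove 1 0) = _
        rw [Fin.insertNth_apply_succAbove]
        simp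
      · exact Fin.insertNth_apply_same _ _ _
      · change Fin.insertNth (α := fun _ => MvPolynomial (Fin 2) K) (1 : Fin 3) _ _
          (Fin.succAbove 1 1) = _
        rw [Fin.insertNth_apply_succAbove]
        have : (Fin.succAbove 1 1 : Fin 3) = 2 := rfl
        simp [this]
    rw [h1, monomial_exponent]
    simp
  change (localEquation (homogenization f) ![0, 1, 0] (chartIndex ![0, 1, 0]) :
    MvPowerSeries (Fin 2) K).order = _
  rw [hchart, heq]
  have hdeg : ∀ s ∈ f.support, (exponent (s 0) (f.totalDegree - s 0 - s 1)).degree =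
      f.totalDegree - s 1 := fun s hs => by
    have := add_le_totalDegree hs
    rw [exponent_degree]
    omega
  refine order_sum_monomial (fun s hs t ht hst => ?_) (fun s hs => mem_support_iff.1 hs) ?_
    fun s hs => ?_
  · have h0 := DFunLike.congr_fun hst 0
    have h1 := DFunLike.congr_fun hst 1
    simp only [exponent_apply_zero, exponent_apply_one] at h0 h1
    have h2 := add_le_totalDegree hs
    have h3 := add_le_totalDegree ht
    ext i
    fin_cases i
    · exact h0
    · change s 1 = t 1
      omega
  · obtain ⟨s, hs, h⟩ := exists_mem_support_eq_degreeOf hf 1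
    exact ⟨s, hs, by rw [hdeg s hs, h]⟩
  · rw [hdeg s hs]
    have := monomial_le_degreeOf 1 hs
    omega

end Multiplicity

/-! ### The corner term and the shape of the equation in (b). -/

section Terms

variable {K : Type*} [Field K] {f : MvPolynomial (Fin 2) K}

theorem eq_exponent_iff {s : Fin 2 →₀ ℕ} {i j : ℕ} : s = exponent i j ↔ s 0 = i ∧ s 1 = j := by
  refine ⟨?_, fun ⟨h0, h1⟩ => ?_⟩
  · rintro rfl
    exact ⟨rfl, rfl⟩
  · ext k
    fin_cases k
    · exact h0
    · exact h1

/-- A term in the box of partial degrees can have degree `deg_X f + deg_Y f` only at the corner. -/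
theorem coeff_multidegree_ne_zero_iff (hf : f ≠ 0) :
    coeff (multidegree f) f ≠ 0 ↔ f.totalDegree = f.degreeOf 0 + f.degreeOf 1 := by
  constructor
  · intro h
    refine le_antisymm ?_ (add_le_totalDegree (mem_support_iff.2 h))
    refine Finset.sup_le fun s hs => ?_
    rw [Finsupp.sum_fintype _ _ (fun _ => rfl), Fin.sum_univ_two]
    exact add_le_add (monomial_le_degreeOf 0 hs) (monomial_le_degreeOf 1 hs)
  · intro h
    obtain ⟨s, hs, hsd⟩ := Finset.exists_mem_eq_sup f.support (support_nonempty.2 hf)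
      fun s => s.sum fun _ e => e
    have h1 : s 0 + s 1 = f.totalDegree := by
      rw [totalDegree, hsd, Finsupp.sum_fintype _ _ (fun _ => rfl), Fin.sum_univ_two]
    have h2 := monomial_le_degreeOf 0 hs
    have h3 := monomial_le_degreeOf 1 hs
    have : s = multidegree f := by
      ext i
      fin_cases i
      · change s 0 = f.degreeOf 0
        omega
      · change s 1 = f.degreeOf 1
        omega
    rw [← this]
    exact mem_support_iff.1 hs

/-- The curve has an equation `X ^ m * Y ^ l + ⋯` as in the theorem if and only if its degree is
the sum of its partial degrees `m` and `l`. -/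
theorem exists_eq_X_pow_mul_X_pow_add_iff (hf : Irreducible f) {l m : ℕ} :
    (∃ c : K, c ≠ 0 ∧ ∃ g : MvPolynomial (Fin 2) K,
      C c * f = X 0 ^ m * X 1 ^ l + g ∧ f.totalDegree = m + l ∧
        g.totalDegree < m + l ∧ g.degreeOf 0 ≤ m ∧ g.degreeOf 1 ≤ l) ↔
      f.degreeOf 0 = m ∧ f.degreeOf 1 = l ∧ f.totalDegree = m + l := by
  classical
  have hmon : (X 0 ^ m * X 1 ^ l : MvPolynomial (Fin 2) K) = monomial (exponent m l) 1 := by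
    rw [monomial_exponent, C_1, one_mul]
  have hcoeff : ∀ (c : K) s, coeff s (C c * f) = c * coeff s f := fun c s => coeff_C_mul s c f
  constructor
  · rintro ⟨c, hc, g, hg, hd, hgd, hg0, hg1⟩
    have hle : ∀ s ∈ f.support, s 0 ≤ m ∧ s 1 ≤ l := by
      intro s hs
      have h1 : coeff s (C c * f) ≠ 0 := by
        rw [hcoeff]
        exact mul_ne_zero hc (mem_support_iff.1 hs)
      rw [hg, hmon, coeff_add, coeff_monomial] at h1
      by_cases hsg : coeff s g = 0
      · rw [hsg, add_zero, ite_ne_right_iff] at h1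
        rw [← h1.1]
        exact ⟨le_rfl, le_rfl⟩
      · exact ⟨(monomial_le_degreeOf 0 (mem_support_iff.2 hsg)).trans hg0,
          (monomial_le_degreeOf 1 (mem_support_iff.2 hsg)).trans hg1⟩
    have hmem : exponent m l ∈ f.support := by
      have h1 : coeff (exponent m l) g = 0 := by
        by_contra h
        exact absurd (add_le_totalDegree (mem_support_iff.2 h)) (not_le.2 hgd)
      have h2 := hcoeff c (exponent m l)
      rw [hg, hmon, coeff_add, coeff_monomial, if_pos rfl, h1, add_zero] at h2
      exact mem_support_iff.2 (right_ne_zero_of_mul (h2 ▸ one_ne_zero))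
    exact ⟨le_antisymm (degreeOf_le_iff.2 fun s hs => (hle s hs).1) (monomial_le_degreeOf 0 hmem),
      le_antisymm (degreeOf_le_iff.2 fun s hs => (hle s hs).2) (monomial_le_degreeOf 1 hmem), hd⟩
  · rintro ⟨rfl, rfl, hd⟩
    have hne := (coeff_multidegree_ne_zero_iff hf.ne_zero).2 hd
    have hmulti : multidegree f = exponent (f.degreeOf 0) (f.degreeOf 1) :=
      eq_exponent_iff.2 ⟨rfl, rfl⟩
    rw [hmulti] at hne
    refine ⟨(coeff (exponent (f.degreeOf 0) (f.degreeOf 1)) f)⁻¹, inv_ne_zero hne, C _ * f - _,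
      (add_sub_cancel _ _).symm, hd, ?_⟩
    set a := coeff (exponent (f.degreeOf 0) (f.degreeOf 1)) f
    set g := C a⁻¹ * f - X 0 ^ f.degreeOf 0 * X 1 ^ f.degreeOf 1 with hg
    have hsupp : ∀ s ∈ g.support, s ∈ f.support ∧ s ≠ exponent (f.degreeOf 0) (f.degreeOf 1) := by
      intro s hs
      rw [mem_support_iff, hg, coeff_sub, hcoeff, hmon, coeff_monomial] at hs
      have hs' : s ≠ exponent (f.degreeOf 0) (f.degreeOf 1) := by
        rintro rfl
        exact hs (by rw [if_pos rfl, inv_mul_cancel₀ hne, sub_self])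
      rw [if_neg hs'.symm, sub_zero] at hs
      exact ⟨mem_support_iff.2 (right_ne_zero_of_mul hs), hs'⟩
    refine ⟨?_, degreeOf_le_iff.2 fun s hs => monomial_le_degreeOf 0 (hsupp s hs).1,
      degreeOf_le_iff.2 fun s hs => monomial_le_degreeOf 1 (hsupp s hs).1⟩
    -- Needed when `g = 0`, whose total degree is `0` by convention; `f` is not constant, being
    -- irreducible.
    have hpos : 0 < f.degreeOf 0 + f.degreeOf 1 := by
      obtain ⟨i, hi⟩ := exists_degreeOf_ne_zero hf
      fin_cases i
      · exact Nat.add_pos_left (Nat.pos_of_ne_zero hi) _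
      · exact Nat.add_pos_right _ (Nat.pos_of_ne_zero hi)
    refine (Finset.sup_lt_iff hpos).2 fun s hs => ?_
    obtain ⟨hsf, hne⟩ := hsupp s hs
    rw [Finsupp.sum_fintype _ _ (fun _ => rfl), Fin.sum_univ_two]
    rw [Ne, eq_exponent_iff] at hne
    have h2 := monomial_le_degreeOf 0 hsf
    have h3 := monomial_le_degreeOf 1 hsf
    omega

end Terms

end PlaneCurve

/-! ### The equivalence. -/

open MvPolynomial PlaneCurve in
theorem theorem5p2 {K L : Type*} [Field K] [Field L] [Algebra K L]
    -- the irreducible plane curve `f(X, Y) = 0`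
    (f : MvPolynomial (Fin 2) K) (hf : Irreducible f)
    -- `L` is its function field
    [Algebra (CoordinateRing f) L] [IsScalarTower K (CoordinateRing f) L]
    [IsFractionRing (CoordinateRing f) L]
    -- the functions `x` and `y`
    (x y : L) (hgen : IntermediateField.adjoin K {x, y} = ⊤) (hxy : aeval ![x, y] f = 0)
    (l m : ℕ) :
    List.TFAE [
      (¬ ∃ P : Place K L, P.IsPole x ∧ P.IsPole y) ∧
        (∃ D : Place K L →₀ ℕ, IsPoleDivisor D x ∧ divisorDegree D = l) ∧
        (∃ D : Place K L →₀ ℕ, IsPoleDivisor D y ∧ divisorDegree D = m),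
      ∃ c : K, c ≠ 0 ∧ ∃ g : MvPolynomial (Fin 2) K,
        C c * f = X 0 ^ m * X 1 ^ l + g ∧ f.totalDegree = m + l ∧
          g.totalDegree < m + l ∧ g.degreeOf 0 ≤ m ∧ g.degreeOf 1 ≤ l,
      multiplicity (homogenization f) (O₁ K) = l ∧
        multiplicity (homogenization f) (O₂ K) = m ∧ m + l = f.totalDegree] := by
  have hker := aeval_eq_zero_iff_dvd hf hgen hxy
  have hfin := finiteDimensional_adjoin_of_transcendental hf.ne_zero hgen hxy
  have hpoles : (¬ ∃ P : Place K L, P.IsPole x ∧ P.IsPole y) ↔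
      f.totalDegree = f.degreeOf 0 + f.degreeOf 1 := by
    rw [← coeff_multidegree_ne_zero_iff hf.ne_zero, not_iff_not]
    constructor
    · rintro ⟨P, hPx, hPy⟩
      refine coeff_multidegree_eq_zero_of_isPole hxy (P := P) fun i => ?_
      fin_cases i
      exacts [hPx, hPy]
    · intro h
      obtain ⟨P, hP⟩ := exists_common_pole hfin (fun g => (hker g).1) h
      exact ⟨P, hP 0, hP 1⟩
  have hdeg : ∀ (z : L) (n : ℕ), (∃ D : Place K L →₀ ℕ, IsPoleDivisor D z ∧ divisorDegree D = n) →
      ∀ k : ℕ, (∃ D : Place K L →₀ ℕ, IsPoleDivisor D z ∧ divisorDegree D = k) ↔ n = k := by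
    rintro z n ⟨D, hD, rfl⟩ k
    refine ⟨?_, fun h => ⟨D, hD, h⟩⟩
    rintro ⟨D', hD', rfl⟩
    rw [hD.unique hD']
  -- These bounds make the natural-number subtractions in the multiplicities exact.
  have hle0 := degreeOf_le_totalDegree f 0
  have hle1 := degreeOf_le_totalDegree f 1
  tfae_have 1 ↔ 2 := by
    rw [exists_eq_X_pow_mul_X_pow_add_iff hf, hpoles,
      hdeg x _ (exists_isPoleDivisor_fst hf.ne_zero hgen hker),
      hdeg y _ (exists_isPoleDivisor_snd hf.ne_zero hgen hker)]
    omega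
  tfae_have 2 ↔ 3 := by
    rw [exists_eq_X_pow_mul_X_pow_add_iff hf, multiplicity_O₁ hf.ne_zero,
      multiplicity_O₂ hf.ne_zero, Nat.cast_inj, Nat.cast_inj]
    omega
  tfae_finish
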